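/- **Setting.** A system consists of clients, one execution group of $2f_e+1$ replicas, at most $f_e$ of them Byzantine, and one agreement group of $3f_a+1$ replicas, at most $f_a$ of them Byzantine; any number of clients may be Byzantine. Messages are authenticated by unforgeable MACs and signatures. The network between clients and execution replicas is partially synchronous: there are an unknown time GST and an unknown bound $\Delta$ such that a message sent between correct nodes at a time $\ge$ GST arrives within $\Delta$ (earlier ones may be late or lost). Timers of correct nodes expire, and sleeping code whose condition holds is resumed. The application is a deterministic state machine. Let $k_e,k_a\ge 1$ be the execution and agreement checkpoint intervals, $|r|\ge 1$ the capacity of each subchannel of the request channel, $|c|\ge k_e$ the capacity of the commit channel, and $\text{AG-WIN}\ge k_a$. Each handler below runs atomically except where it blocks. **Client** $c$ (counter $t_c$, initially $1$). To issue a write $w$ (only when no earlier one is pending) it broadcasts the signed request $r=\langle \mathrm{Write},w,c,t_c\rangle$ to the execution group and repeats this whenever its retry timer expires. It stores the first authenticated reply with counter $t_c$ of each replica, accepts a value once $f_e+1$ replicas sent it, and then increments $t_c$. **Execution replica** (initially $s_n=0$, $t[\cdot]=0$, $u[\cdot]=\varnothing$). On a request $\langle \mathrm{Write},w,c,t_c\rangle$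 with valid MAC: if $t_c\le t[c]$, it sends the reply stored in $u[c]$ if that has counter $t_c$; otherwise, if the signature is valid, it sets $t[c]:=t_c$ and calls $move\_window(c,t_c)$ and $send(c,t_c,r)$ on the request channel. Its main loop calls $receive(s_n+1)$ on the commit channel; on $\langle \mathrm{TooOld},s'\rangle$ it asks for a checkpoint and repeats; on $\langle \mathrm{Execute},r,s\rangle$ it increments $s_n$, executes $r$ unless $u[c]$ has a counter $\ge t_c$, stores counter and result in $u[c]$ and sends them to the client, and, if $k_e\mid s_n$, calls $gen\_cp(s_n,(u,app))$. On $stable\_cp(s,(u',app'))$ it calls $move\_window(s+1)$ on the commit channel and, if $s>s_n$, sets $(s_n,u,app):=(s,u',app')$. **Agreement replica** (initially $s_n=0$, $t[\cdot]=0$, $t^+[\cdot]=1$, $hist$ empty, $win=[1,\text{AG-WIN}]$). For every client $c$ it loops over $receive(c,t^+[c])$ on the request channel: on $\langle\mathrm{TooOld},t'\rangle$ it sets $t^+[c]:=\max(t^+[c],t')$; on a request $r$ with counter $t_c$ it calls $order(r)$ and sets $t^+[c]:=\max(t^+[c],t_c+1)$. On the blocking callback $deliver(s,r)$ it sleeps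 until $s\le\max(win)$, returns if a checkpoint has meanwhile brought $s_n$ to at least $s$, and otherwise sets $s_n:=s$, $t[c]:=\max(t[c],t_c)$, $t^+[c]:=\max(t^+[c],t_c+1)$, appends $\langle\mathrm{Execute},r,s\rangle$ to $hist$ (which keeps the last $|c|$ entries), sends that message at position $s$ of the commit channel, and, once this $send$ has returned and if $k_a\mid s$, calls $gen\_cp(s,(t,hist))$ with the values reached at $s$. On $stable\_cp(s,(t',hist'))$ it calls $move\_window(s-|hist'|+1)$ on the commit channel and $gc(s+1)$; if $s>s_n$ it sets $s_n:=s$, $t:=t'$, $hist:=hist'$, $t^+[c]:=\max(t^+[c],t'[c]+1)$ for all $c$, and sends the entries of $hist'$ above the old $s_n$ one after the other on the commit channel; finally it anchors $win$ as $[s+1,s+\text{AG-WIN}]$ (never moving it backwards). **Assumed properties of the components** (all about correct replicas). *Channels* (request channel: senders are the execution replicas, receivers the agreement replicas, one subchannel per client; commit channel: the other direction, one subchannel; $f_s,f_r$ are the fault bounds of the sender and receiver group). Each receiver endpoint has per subchannel a window with a non-decreasing lower limit, initially $1$, which its own $move\_window(p)$ calls raise to at least $p$; a lower limit $q>1$ requires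 that a correct sender or a correct receiver called $move\_window$ with an argument $\ge q$. A received message was sent at that position by a correct sender, and the position lies in the receiver's window; $\langle\mathrm{TooOld},p'\rangle$ is returned for position $p$ only if $p<p'\le$ the lower limit, and $receive$ returns on positions below the window. A $send$ at position $p$ returns only if $p$ is below the upper end of the window of some correct receiver. (I) If $send$ of the same message at the same position has returned at $f_s+1$ correct senders, every $receive$ of a correct receiver for that position eventually returns. (II) If $f_r+1$ correct receivers have window lower limits $\ge q$, every $send$ of a correct sender at a position $<q+\text{capacity}$ eventually returns. (III) If $f_s+1$ correct senders call $move\_window$ with arguments $\ge q$, all correct receivers' lower limits eventually are $\ge q$. *Agreement black-box.* Two correct replicas never deliver different messages for the same sequence number; only requests with valid signatures are delivered; sequence numbers at a replica start at $1$, increase, skip only garbage-collected numbers, and after $gc(g)$ none below $g$ is delivered; the next $deliver$ is invoked only after the previous one has returned. Liveness: if each of $2f_a+1$ correct replicas has called $order(r)$, or was itself delivered $r$, or garbage-collected a sequence number for which a correct replica was delivered $r$, then there are a sequence number $s$ and $f_a+1$ correct replicas each of which eventually is delivered $r$ for $s$, or garbage-collects $s$ while some correct replica is delivered $r$ for $s$,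 or never returns from one of its $deliver$ callbacks. *Checkpoint component* (one per group, $f$ its fault bound). The sequence numbers of $stable\_cp$ at a replica increase; a stable checkpoint was generated by a correct replica of the group; if it is delivered at one correct replica, each correct replica of the group eventually delivers it or a newer one; if $f+1$ correct replicas generate the same checkpoint, it or a newer one is eventually delivered at some correct replica of the group. **Theorem (E-Liveness).** In every run with these properties, every write request issued by a correct client is eventually answered: the client accepts a reply to it. -/

import Mathlib

/-! # The Spider replication protocol with one execution group

A run of the system is an infinite sequence of events, at most one per step.  An event hands one
input to one node (a client, an execution replica or an agreement replica).  Correct nodes react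
to their inputs by running their protocol code, which is written below as deterministic handlers
returning the new local state and the list of actions performed (messages sent, calls made to a
component).  Everything else (network, faulty nodes, message channels, agreement black-box,
checkpoint components, scheduling) shows up only through the inputs that it chooses to deliver
and is restricted only by the properties stated in the second half of this file. -/

namespace Spider

/-! ## Messages and parameters -/

/-- A client request `⟨Write, op, client, counter⟩`.  The flag `sig` says whether the signature
attached to the request verifies as a signature of `client`. -/
structure Request (C Op : Type*) where
  client : C
  counter : ℕ
  op : Op
  sig : Bool

/-- The message `⟨Execute, req, seq⟩`. -/
structure Execute (C Op : Type*) where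
  req : Request C Op
  seq : ℕ

/-- Result of a `receive` call of a channel: a message, or `⟨TooOld, p⟩`. -/
inductive RecvResult (M : Type*) where
  | msg (m : M)
  | tooOld (p : ℕ)

/-- The replicated application, a deterministic state machine. -/
structure App (St Op V : Type*) where
  init : St
  exec : St → Op → St × V

/-- Static parameters of a deployment, and which nodes are correct. Faults are Byzantine. -/
structure Deployment (C Op V St : Type*) where
  /-- number of tolerated faults in the execution group, which has `2 * fe + 1` replicas -/
  fe : ℕ
  /-- number of tolerated faults in the agreement group, which has `3 * fa + 1` replicas -/
  fa : ℕ
  /-- execution checkpoint interval -/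
  ke : ℕ
  /-- agreement checkpoint interval -/
  ka : ℕ
  /-- capacity of each subchannel of the request channel -/
  capR : ℕ
  /-- capacity of the subchannel of the commit channel -/
  capC : ℕ
  /-- size `AG-WIN` of the window that forces periodic agreement checkpoints -/
  agWin : ℕ
  app : App St Op V
  correctClients : Set C
  correctExec : Finset (Fin (2 * fe + 1))
  correctAgree : Finset (Fin (3 * fa + 1))
  ke_pos : 0 < ke
  ka_pos : 0 < ka
  capR_pos : 0 < capR
  ke_le_capC : ke ≤ capC
  ka_le_agWin : ka ≤ agWin
  faultyExec_card : correctExecᶜ.card ≤ fe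
  faultyAgree_card : correctAgreeᶜ.card ≤ fa

variable {C Op V St : Type*}

/-- Contents of an execution checkpoint: last reply per client and application state. -/
abbrev ExecCp (C V St : Type*) := (C → Option (ℕ × V)) × St

/-- Contents of an agreement checkpoint: last agreed counter per client and recent `Execute`s. -/
abbrev AgreeCp (C Op : Type*) := (C → ℕ) × List (Execute C Op)

/-! ## Client -/

structure ClientState (C Op V : Type*) (nE : ℕ) where
  /-- counter value for the current or, if there is none, the next request -/
  counter : ℕ
  /-- the request for which the client is collecting replies -/
  pending : Option (Request C Op)
  replies : Fin nE → Option V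

inductive ClientIn (Op V : Type*) (nE : ℕ) where
  /-- the user of the client invokes `write(w)` -/
  | issue (w : Op)
  /-- the retry timer expires -/
  | retry
  /-- message `⟨Result, v, t⟩` claiming to come from replica `e`; `mac`: its MAC verifies -/
  | result (e : Fin nE) (t : ℕ) (v : V) (mac : Bool)

inductive ClientOut (C Op V : Type*) where
  /-- send a request to all execution replicas -/
  | broadcast (r : Request C Op)
  /-- `write` returns: the client accepts reply `v` to its request with counter `t` -/
  | accept (t : ℕ) (v : V)

def clientInit (nE : ℕ) : ClientState C Op V nE := ⟨1, none, fun _ => none⟩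

def clientStep [DecidableEq V] (fe : ℕ) (c : C) (σ : ClientState C Op V (2 * fe + 1)) :
    ClientIn Op V (2 * fe + 1) → ClientState C Op V (2 * fe + 1) × List (ClientOut C Op V)
  | .issue w =>
    match σ.pending with
    | none =>
      let r : Request C Op := ⟨c, σ.counter, w, true⟩
      (⟨σ.counter, some r, fun _ => none⟩, [.broadcast r])
    | some _ => (σ, [])
  | .retry =>
    match σ.pending with
    | none => (σ, [])
    | some r => (σ, [.broadcast r])
  | .result e t v mac =>
    -- only the first authenticated reply of each replica to the current request counts
    if σ.pending.isSome = true ∧ mac = true ∧ t = σ.counter ∧ (σ.replies e).isNone = true then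
      let replies := Function.update σ.replies e (some v)
      if fe + 1 ≤ (Finset.univ.filter fun e' => replies e' = some v).card then
        (⟨σ.counter + 1, none, replies⟩, [.accept t v])
      else
        (⟨σ.counter, σ.pending, replies⟩, [])
    else (σ, [])

/-! ## Execution replica -/

structure ExecState (C V St : Type*) where
  /-- sequence number of the last processed request -/
  sn : ℕ
  app : St
  /-- `t[c]`: counter of the latest request of `c` that was forwarded -/
  seen : C → ℕ
  /-- `u[c]`: counter of, and reply to, the latest executed request of `c` -/
  last : C → Option (ℕ × V)
  /-- position of the outstanding `receive` call of the main loop on the commit channel -/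
  pos : ℕ

inductive ExecIn (C Op V St : Type*) where
  /-- a client request arrives over the network; `mac`: its MAC verifies at this replica -/
  | write (r : Request C Op) (mac : Bool)
  /-- the outstanding `receive` call on the commit channel returns -/
  | received (x : RecvResult (Execute C Op))
  /-- a `send` call on the request channel returns -/
  | sent (c : C) (p : ℕ) (r : Request C Op)
  /-- callback `stable_cp` -/
  | stable (s : ℕ) (x : ExecCp C V St)

inductive ExecOut (C Op V St : Type*) where
  | reqMove (c : C) (p : ℕ)
  | reqSend (c : C) (p : ℕ) (r : Request C Op)
  | commitMove (p : ℕ)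
  | reply (c : C) (t : ℕ) (v : V)
  | genCp (s : ℕ) (x : ExecCp C V St)
  | fetchCp (p : ℕ)

def execInit (app : App St Op V) : ExecState C V St :=
  ⟨0, app.init, fun _ => 0, fun _ => none, 1⟩

/-- Is a request with counter `t` newer than the last executed one? -/
def isNew (u : Option (ℕ × V)) (t : ℕ) : Bool :=
  match u with
  | none => true
  | some (t', _) => decide (t' < t)

/-- The part of the main loop that processes the request at the next sequence number. -/
def execRequest [DecidableEq C] (ke : ℕ) (app : App St Op V) (σ : ExecState C V St)
    (r : Request C Op) : ExecState C V St × List (ExecOut C Op V St) :=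
  let sn := σ.sn + 1
  let res := app.exec σ.app r.op
  let new := isNew (σ.last r.client) r.counter
  let app' := if new = true then res.1 else σ.app
  let last' := if new = true then
    Function.update σ.last r.client (some (r.counter, res.2)) else σ.last
  (⟨sn, app', σ.seen, last', sn + 1⟩,
    (if new = true then [.reply r.client r.counter res.2] else []) ++
    (if sn % ke = 0 then [.genCp sn (last', app')] else []))

def execStep [DecidableEq C] (ke : ℕ) (app : App St Op V) (σ : ExecState C V St) :
    ExecIn C Op V St → ExecState C V St × List (ExecOut C Op V St)
  | .write r mac =>
    if mac = false then (σ, [])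
    else if r.counter ≤ σ.seen r.client then
      match σ.last r.client with
      | some (t, v) => (σ, if t = r.counter then [.reply r.client t v] else [])
      | none => (σ, [])
    else if r.sig = false then (σ, [])
    else
      ({ σ with seen := Function.update σ.seen r.client r.counter },
        [.reqMove r.client r.counter, .reqSend r.client r.counter r])
  | .received (.msg x) => execRequest ke app σ x.req
  | .received (.tooOld p) => ({ σ with pos := σ.sn + 1 }, [.fetchCp p])
  | .sent _ _ _ => (σ, [])
  | .stable s x =>
    if σ.sn < s then
      ({ σ with sn := s, last := x.1, app := x.2 }, [.commitMove (s + 1)])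
    else (σ, [.commitMove (s + 1)])

/-! ## Agreement replica -/

/-- Progress of the (blocking) `deliver` callback. -/
inductive DeliverPhase (C Op : Type*) where
  /-- sleeping until `s` is covered by the window `win` -/
  | waiting (s : ℕ) (r : Request C Op)
  /-- blocked in the `send` call for `s`; `x` is the replica state reached with `s` -/
  | sending (s : ℕ) (x : AgreeCp C Op)

/-- A `stable_cp` callback that is still inserting missing `Execute`s into the commit channel, one
after the other; the `send` call for the first element of `todo` is outstanding. -/
structure CpTask (C Op : Type*) where
  seq : ℕ
  todo : List (Execute C Op)

structure AgreeState (C Op : Type*) where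
  sn : ℕ
  /-- `t[c]`: counter of the latest agreed request of `c` -/
  t : C → ℕ
  /-- `t⁺[c]`: counter of the request of `c` to be received next -/
  next : C → ℕ
  /-- position of the outstanding `receive` call on the request subchannel of `c` -/
  pos : C → ℕ
  /-- the last `Execute` messages, as many as the commit channel has room for -/
  hist : List (Execute C Op)
  /-- upper limit of `win` -/
  winMax : ℕ
  /-- the `deliver` callback in progress, if any -/
  deliv : Option (DeliverPhase C Op)
  /-- the `stable_cp` callbacks in progress -/
  tasks : List (CpTask C Op)

inductive AgreeIn (C Op : Type*) where
  /-- the outstanding `receive` call on the request subchannel of `c` returns -/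
  | received (c : C) (x : RecvResult (Request C Op))
  /-- callback `deliver` of the agreement black-box -/
  | deliver (s : ℕ) (r : Request C Op)
  /-- the scheduler lets the sleeping `deliver` callback check its condition -/
  | resume
  /-- a `send` call on the commit channel returns -/
  | sent (p : ℕ) (x : Execute C Op)
  /-- callback `stable_cp` -/
  | stable (s : ℕ) (x : AgreeCp C Op)

inductive AgreeOut (C Op : Type*) where
  | order (r : Request C Op)
  | commitSend (p : ℕ) (x : Execute C Op)
  | commitMove (p : ℕ)
  | genCp (s : ℕ) (x : AgreeCp C Op)
  | gc (s : ℕ)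

def agreeInit (agWin : ℕ) : AgreeState C Op :=
  ⟨0, fun _ => 0, fun _ => 1, fun _ => 1, [], agWin, none, []⟩

/-- Append to a history that keeps the last `cap` elements. -/
def pushHist {α : Type*} (cap : ℕ) (l : List α) (x : α) : List α :=
  (l ++ [x]).drop ((l ++ [x]).length - cap)

/-- The `send` call that a `stable_cp` callback has outstanding. -/
def CpTask.current (T : CpTask C Op) : List (AgreeOut C Op) :=
  match T.todo with
  | [] => []
  | x :: _ => [.commitSend x.seq x]

/-- Does the callback wait for the `send` call at position `p`? -/
def CpTask.waitsFor (T : CpTask C Op) (p : ℕ) : Bool :=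
  match T.todo with
  | [] => false
  | x :: _ => decide (x.seq = p)

def CpTask.advance (T : CpTask C Op) (p : ℕ) : CpTask C Op :=
  if T.waitsFor p = true then ⟨T.seq, T.todo.tail⟩ else T

/-- Store a list of `stable_cp` callbacks; those with nothing left to send finish by anchoring `win`
directly after their checkpoint (`win` never moves backwards). -/
def settle (agWin : ℕ) (σ : AgreeState C Op) (tasks : List (CpTask C Op)) : AgreeState C Op :=
  { σ with
    tasks := tasks.filter fun T => !T.todo.isEmpty
    winMax := (tasks.filter fun T => T.todo.isEmpty).foldl
      (fun w T => max w (T.seq + agWin)) σ.winMax }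

def agreeStep [DecidableEq C] (ka capC agWin : ℕ) (σ : AgreeState C Op) :
    AgreeIn C Op → AgreeState C Op × List (AgreeOut C Op)
  | .received c (.tooOld p) =>
    let nx := max (σ.next c) p
    ({ σ with next := Function.update σ.next c nx, pos := Function.update σ.pos c nx }, [])
  | .received c (.msg r) =>
    let nx := max (σ.next c) (r.counter + 1)
    ({ σ with next := Function.update σ.next c nx, pos := Function.update σ.pos c nx }, [.order r])
  | .deliver s r => ({ σ with deliv := some (.waiting s r) }, [])
  | .resume =>
    match σ.deliv with
    | some (.waiting s r) =>
      if σ.winMax < s then (σ, [])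
      -- a checkpoint has skipped `s` (and garbage-collected it) in the meantime
      else if s ≤ σ.sn then ({ σ with deliv := none }, [])
      else
        let t' := Function.update σ.t r.client (max (σ.t r.client) r.counter)
        let hist' := pushHist capC σ.hist ⟨r, s⟩
        ({ σ with
            sn := s
            t := t'
            next := Function.update σ.next r.client (max (σ.next r.client) (r.counter + 1))
            hist := hist'
            deliv := some (.sending s (t', hist')) },
          [.commitSend s ⟨r, s⟩])
    | _ => (σ, [])
  | .sent p _ =>
    let tasks := σ.tasks.map fun T => T.advance p
    let outs := (σ.tasks.filter fun T => T.waitsFor p).flatMap fun T => (T.advance p).current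
    let σ' := settle agWin σ tasks
    match σ.deliv with
    | some (.sending s x) =>
      if s = p then
        ({ σ' with deliv := none }, (if s % ka = 0 then [.genCp s x] else []) ++ outs)
      else (σ', outs)
    | _ => (σ', outs)
  | .stable s x =>
    let calls : List (AgreeOut C Op) := [.commitMove (s + 1 - x.2.length), .gc (s + 1)]
    if σ.sn < s then
      let T : CpTask C Op := ⟨s, x.2.filter fun m => decide (σ.sn < m.seq)⟩
      (settle agWin
        { σ with sn := s, t := x.1, hist := x.2, next := fun c => max (σ.next c) (x.1 c + 1) }
        (T :: σ.tasks),
        calls ++ T.current)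
    else
      ({ σ with winMax := max σ.winMax (s + agWin) }, calls)

/-! ## Runs -/

inductive Event (C Op V St : Type*) (nE nA : ℕ) where
  | idle
  | client (c : C) (i : ClientIn Op V nE)
  | exec (e : Fin nE) (i : ExecIn C Op V St)
  | agree (a : Fin nA) (i : AgreeIn C Op)

/-- The local states of all nodes.  The entry of a faulty node is meaningless; no property below
refers to it. -/
structure State (C Op V St : Type*) (nE nA : ℕ) where
  client : C → ClientState C Op V nE
  exec : Fin nE → ExecState C V St
  agree : Fin nA → AgreeState C Op

namespace Deployment

variable [DecidableEq C] [DecidableEq V] (D : Deployment C Op V St)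

abbrev Run (D : Deployment C Op V St) := ℕ → Event C Op V St (2 * D.fe + 1) (3 * D.fa + 1)

def step (σ : State C Op V St (2 * D.fe + 1) (3 * D.fa + 1)) :
    Event C Op V St (2 * D.fe + 1) (3 * D.fa + 1) →
      State C Op V St (2 * D.fe + 1) (3 * D.fa + 1)
  | .idle => σ
  | .client c i =>
    { σ with client := Function.update σ.client c (clientStep D.fe c (σ.client c) i).1 }
  | .exec e i =>
    { σ with exec := Function.update σ.exec e (execStep D.ke D.app (σ.exec e) i).1 }
  | .agree a i =>
    { σ with agree := Function.update σ.agree a (agreeStep D.ka D.capC D.agWin (σ.agree a) i).1 }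

/-- The state before the event of step `n`. -/
def state (ρ : D.Run) : ℕ → State C Op V St (2 * D.fe + 1) (3 * D.fa + 1)
  | 0 => ⟨fun _ => clientInit _, fun _ => execInit D.app, fun _ => agreeInit D.agWin⟩
  | n + 1 => D.step (state ρ n) (ρ n)

/-- Client `c` performs action `o` in step `n`. -/
def clientDoes (ρ : D.Run) (n : ℕ) (c : C) (o : ClientOut C Op V) : Prop :=
  ∃ i, ρ n = .client c i ∧ o ∈ (clientStep D.fe c ((D.state ρ n).client c) i).2

/-- Execution replica `e` performs action `o` in step `n`. -/
def execDoes (ρ : D.Run) (n : ℕ) (e : Fin (2 * D.fe + 1)) (o : ExecOut C Op V St) : Prop :=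
  ∃ i, ρ n = .exec e i ∧ o ∈ (execStep D.ke D.app ((D.state ρ n).exec e) i).2

/-- Agreement replica `a` performs action `o` in step `n`. -/
def agreeDoes (ρ : D.Run) (n : ℕ) (a : Fin (3 * D.fa + 1)) (o : AgreeOut C Op) : Prop :=
  ∃ i, ρ n = .agree a i ∧ o ∈ (agreeStep D.ka D.capC D.agWin ((D.state ρ n).agree a) i).2

end Deployment

/-! ## Inter-regional message channels -/

/-- The interaction of the replicas with a channel (senders `S`, receivers `R`, subchannels `K`,
messages `M`); the first argument of each relation is the step. -/
structure ChannelTrace (S R K M : Type*) where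
  send : ℕ → S → K → ℕ → M → Prop
  sendReturns : ℕ → S → K → ℕ → M → Prop
  senderMove : ℕ → S → K → ℕ → Prop
  receiverMove : ℕ → R → K → ℕ → Prop
  /-- a `receive` call for this subchannel and position is outstanding before the step -/
  receiving : ℕ → R → K → ℕ → Prop
  receiveReturns : ℕ → R → K → ℕ → RecvResult M → Prop

/-- The properties of a channel of capacity `cap` that tolerates `fs` faulty senders and `fr` faulty
receivers.  `win n r k` is the lower limit of the window of subchannel `k` at receiver endpoint `r`
before step `n`. -/
structure ChannelTrace.Valid {S R K M : Type*} (T : ChannelTrace S R K M)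
    (okS : Finset S) (okR : Finset R) (fs fr cap : ℕ) (win : ℕ → R → K → ℕ) : Prop where
  win_init : ∀ r ∈ okR, ∀ k, win 0 r k = 1
  win_mono : ∀ r ∈ okR, ∀ k n, win n r k ≤ win (n + 1) r k
  /-- a `move_window` call of the receiver takes effect -/
  win_move : ∀ r ∈ okR, ∀ n k p, T.receiverMove n r k p → p ≤ win (n + 1) r k
  /-- moving a window requires a request by a correct replica -/
  win_origin : ∀ r ∈ okR, ∀ n k, 1 < win n r k →
    (∃ s ∈ okS, ∃ j < n, ∃ p, win n r k ≤ p ∧ T.senderMove j s k p) ∨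
    (∃ r' ∈ okR, ∃ j < n, ∃ p, win n r k ≤ p ∧ T.receiverMove j r' k p)
  /-- a received message was sent by a correct sender, and its position is in the window -/
  receive_msg : ∀ r ∈ okR, ∀ n k p m, T.receiveReturns n r k p (.msg m) →
    (∃ s ∈ okS, ∃ j < n, T.send j s k p m) ∧ win n r k ≤ p ∧ p < win n r k + cap
  /-- `TooOld` is returned only for positions below the window -/
  receive_tooOld : ∀ r ∈ okR, ∀ n k p p', T.receiveReturns n r k p (.tooOld p') →
    p < p' ∧ p' ≤ win n r k
  /-- `receive` does not block on positions below the window -/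
  receive_below : ∀ r ∈ okR, ∀ n k p, T.receiving n r k p → p < win n r k →
    ∃ j ≥ n, ∃ x, T.receiveReturns j r k p x
  /-- `send` calls block on positions above the window -/
  send_blocks : ∀ s ∈ okS, ∀ n k p m, T.sendReturns n s k p m →
    (∃ j < n, T.send j s k p m) ∧ ∃ r ∈ okR, p < win n r k + cap
  /-- what `fs + 1` correct senders have sent is received, unless it is skipped -/
  liveness1 : ∀ k p m, ∀ Q ⊆ okS, fs + 1 ≤ Q.card → (∀ s ∈ Q, ∃ n, T.sendReturns n s k p m) →
    ∀ r ∈ okR, ∀ n, T.receiving n r k p → ∃ j ≥ n, ∃ x, T.receiveReturns j r k p x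
  /-- `send` calls return once the window of `fr + 1` correct receivers allows it -/
  liveness2 : ∀ k q, ∀ Q ⊆ okR, fr + 1 ≤ Q.card → (∀ r ∈ Q, ∃ n, q ≤ win n r k) →
    ∀ s ∈ okS, ∀ n p m, T.send n s k p m → p < q + cap → ∃ j > n, T.sendReturns j s k p m
  /-- receivers follow the `move_window` requests of `fs + 1` correct senders -/
  liveness3 : ∀ k q, ∀ Q ⊆ okS, fs + 1 ≤ Q.card →
    (∀ s ∈ Q, ∃ n p, q ≤ p ∧ T.senderMove n s k p) → ∀ r ∈ okR, ∃ n, q ≤ win n r k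

/-- The trace is one of an inter-regional message channel. -/
def ChannelTrace.IsIrmc {S R K M : Type*} (T : ChannelTrace S R K M)
    (okS : Finset S) (okR : Finset R) (fs fr cap : ℕ) : Prop :=
  ∃ win : ℕ → R → K → ℕ, T.Valid okS okR fs fr cap win

/-! ## Checkpoint component -/

/-- The interaction of the replicas `G` of a group with their checkpoint components. -/
structure CheckpointTrace (G X : Type*) where
  /-- call `gen_cp(s, x)` -/
  gen : ℕ → G → ℕ → X → Prop
  /-- callback `stable_cp(s, x)` -/
  stable : ℕ → G → ℕ → X → Prop

structure CheckpointTrace.IsCheckpoint {G X : Type*} (T : CheckpointTrace G X)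
    (ok : Finset G) (f : ℕ) : Prop where
  monotone : ∀ g ∈ ok, ∀ n n' s s' x x', n < n' → T.stable n g s x → T.stable n' g s' x' → s < s'
  safety : ∀ g ∈ ok, ∀ n s x, T.stable n g s x → ∃ g' ∈ ok, ∃ j < n, T.gen j g' s x
  liveness : ∀ g ∈ ok, ∀ n s x, T.stable n g s x → ∀ g' ∈ ok,
    ∃ n' s' x', T.stable n' g' s' x' ∧ (s < s' ∨ s' = s ∧ x' = x)
  liveness2 : ∀ s x, ∀ Q ⊆ ok, f + 1 ≤ Q.card → (∀ g ∈ Q, ∃ n, T.gen n g s x) →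
    ∃ g ∈ ok, ∃ n s' x', T.stable n g s' x' ∧ (s < s' ∨ s' = s ∧ x' = x)

namespace Deployment

variable [DecidableEq C] [DecidableEq V] (D : Deployment C Op V St)

/-! ## The components as used by the protocol -/

/-- One subchannel per client, from the execution group to the agreement group. -/
def requestChannel (ρ : D.Run) :
    ChannelTrace (Fin (2 * D.fe + 1)) (Fin (3 * D.fa + 1)) C (Request C Op) where
  send n e c p r := D.execDoes ρ n e (.reqSend c p r)
  sendReturns n e c p r := ρ n = .exec e (.sent c p r)
  senderMove n e c p := D.execDoes ρ n e (.reqMove c p)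
  receiverMove _ _ _ _ := False
  receiving n a c p := ((D.state ρ n).agree a).pos c = p
  receiveReturns n a c p x :=
    ρ n = .agree a (.received c x) ∧ ((D.state ρ n).agree a).pos c = p

/-- A single subchannel, from the agreement group to the execution group. -/
def commitChannel (ρ : D.Run) :
    ChannelTrace (Fin (3 * D.fa + 1)) (Fin (2 * D.fe + 1)) Unit (Execute C Op) where
  send n a _ p x := D.agreeDoes ρ n a (.commitSend p x)
  sendReturns n a _ p x := ρ n = .agree a (.sent p x)
  senderMove n a _ p := D.agreeDoes ρ n a (.commitMove p)
  receiverMove n e _ p := D.execDoes ρ n e (.commitMove p)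
  receiving n e _ p := ((D.state ρ n).exec e).pos = p
  receiveReturns n e _ p x := ρ n = .exec e (.received x) ∧ ((D.state ρ n).exec e).pos = p

def execCheckpoints (ρ : D.Run) : CheckpointTrace (Fin (2 * D.fe + 1)) (ExecCp C V St) where
  gen n e s x := D.execDoes ρ n e (.genCp s x)
  stable n e s x := ρ n = .exec e (.stable s x)

def agreeCheckpoints (ρ : D.Run) : CheckpointTrace (Fin (3 * D.fa + 1)) (AgreeCp C Op) where
  gen n a s x := D.agreeDoes ρ n a (.genCp s x)
  stable n a s x := ρ n = .agree a (.stable s x)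

/-! ## Agreement black-box -/

/-- The black-box invokes `deliver(s, r)` at replica `a`. -/
def Delivers (ρ : D.Run) (n : ℕ) (a : Fin (3 * D.fa + 1)) (s : ℕ) (r : Request C Op) : Prop :=
  ρ n = .agree a (.deliver s r)

/-- Replica `a` delivers `r` at sequence number `s`, or some correct replica does while `a` has
skipped `s` by garbage collection. -/
def Covers (ρ : D.Run) (a : Fin (3 * D.fa + 1)) (s : ℕ) (r : Request C Op) : Prop :=
  (∃ n, D.Delivers ρ n a s r) ∨
  ((∃ a' ∈ D.correctAgree, ∃ n, D.Delivers ρ n a' s r) ∧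
    ∃ n g, s < g ∧ D.agreeDoes ρ n a (.gc g))

/-- From some point on, `a` is blocked in one and the same `deliver` callback. -/
def Stuck (ρ : D.Run) (a : Fin (3 * D.fa + 1)) : Prop :=
  ∃ N, ∀ n ≥ N, ((D.state ρ n).agree a).deliv.isSome = true

structure IsAgreement (ρ : D.Run) : Prop where
  safety : ∀ a ∈ D.correctAgree, ∀ a' ∈ D.correctAgree, ∀ n n' s r r',
    D.Delivers ρ n a s r → D.Delivers ρ n' a' s r' → r = r'
  validity : ∀ a ∈ D.correctAgree, ∀ n s r, D.Delivers ρ n a s r → r.sig = true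
  /-- the next message is delivered only after the previous callback has completed -/
  blocking : ∀ a ∈ D.correctAgree, ∀ n s r, D.Delivers ρ n a s r →
    ((D.state ρ n).agree a).deliv = none
  /-- sequence numbers start with 1 and have no gaps other than garbage-collected ones -/
  order : ∀ a ∈ D.correctAgree, ∀ n s r, D.Delivers ρ n a s r →
    1 ≤ s ∧ ∀ s', 1 ≤ s' → s' < s →
      (∃ j < n, ∃ r', D.Delivers ρ j a s' r') ∨
      (∃ j < n, ∃ g, s' < g ∧ D.agreeDoes ρ j a (.gc g))
  increasing : ∀ a ∈ D.correctAgree, ∀ n s r, D.Delivers ρ n a s r →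
    ∀ j < n, ∀ s' r', D.Delivers ρ j a s' r' → s' < s
  /-- after `gc(g)` no sequence number below `g` is delivered -/
  collected : ∀ a ∈ D.correctAgree, ∀ n s r, D.Delivers ρ n a s r →
    ∀ j < n, ∀ g, D.agreeDoes ρ j a (.gc g) → g ≤ s
  /-- If `2 * fa + 1` correct replicas receive `r` (from `order`, or from the black-box itself), then
  eventually `fa + 1` correct replicas deliver `r`, where a replica is excused if it has skipped `r`
  by garbage collection or never returns from some `deliver` callback. -/
  liveness : ∀ r, ∀ Q ⊆ D.correctAgree, 2 * D.fa + 1 ≤ Q.card →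
    (∀ a ∈ Q, (∃ n, D.agreeDoes ρ n a (.order r)) ∨ ∃ s, D.Covers ρ a s r) →
    ∃ s, ∃ F ⊆ D.correctAgree, D.fa + 1 ≤ F.card ∧ ∀ a ∈ F, D.Covers ρ a s r ∨ D.Stuck ρ a

/-! ## Cryptography, network and scheduling -/

/-- MACs and signatures of correct nodes cannot be forged. -/
structure Unforgeable (ρ : D.Run) : Prop where
  request_mac : ∀ e ∈ D.correctExec, ∀ n r, r.client ∈ D.correctClients →
    ρ n = .exec e (.write r true) → ∃ j < n, D.clientDoes ρ j r.client (.broadcast r)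
  request_sig : ∀ a ∈ D.correctAgree, ∀ n s r, r.client ∈ D.correctClients → r.sig = true →
    D.Delivers ρ n a s r → ∃ j < n, D.clientDoes ρ j r.client (.broadcast r)
  reply_mac : ∀ c ∈ D.correctClients, ∀ e ∈ D.correctExec, ∀ n t v,
    ρ n = .client c (.result e t v true) → ∃ j < n, D.execDoes ρ j e (.reply c t v)

/-- Partial synchrony: there are a time `gst` and a bound `Δ`, both unknown to the nodes, such that
messages sent between correct nodes from `gst` on arrive within `Δ`.  Messages sent earlier may be
delayed arbitrarily or lost. -/
def PartiallySynchronous (ρ : D.Run) : Prop :=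
  ∃ (time : ℕ → ℝ) (gst Δ : ℝ), Monotone time ∧ Filter.Tendsto time Filter.atTop Filter.atTop ∧
    (∀ c ∈ D.correctClients, ∀ e ∈ D.correctExec, ∀ n r, gst ≤ time n →
      D.clientDoes ρ n c (.broadcast r) →
      ∃ k > n, time k ≤ time n + Δ ∧ ρ k = .exec e (.write r true)) ∧
    (∀ c ∈ D.correctClients, ∀ e ∈ D.correctExec, ∀ n t v, gst ≤ time n →
      D.execDoes ρ n e (.reply c t v) →
      ∃ k > n, time k ≤ time n + Δ ∧ ρ k = .client c (.result e t v true))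

/-- Correct nodes keep running: the retry timer of a client waiting for replies expires again and
again, and a `deliver` callback sleeping on a condition that holds is woken up. -/
structure FairScheduling (ρ : D.Run) : Prop where
  retry : ∀ c ∈ D.correctClients, ∀ n, ((D.state ρ n).client c).pending.isSome = true →
    ∃ k ≥ n, ρ k = .client c .retry ∨ ((D.state ρ k).client c).pending = none
  resume : ∀ a ∈ D.correctAgree, ∀ n s r,
    ((D.state ρ n).agree a).deliv = some (.waiting s r) → s ≤ ((D.state ρ n).agree a).winMax →
    ∃ k ≥ n, ρ k = .agree a .resume

end Deployment

end Spider

namespace Spider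

variable {C Op V St : Type*}

/-! ## Local states along a run -/

namespace Deployment

/-! All correct replicas work on one log. By safety of the agreement black-box there is a function
`R` such that only `R s` is ever delivered at `s`. The counters and history of an agreement replica
are a function of its sequence number (`agreeLog`), and so are the stored replies and application
state of an execution replica (`execLog`). Checkpoints merely copy such states between replicas
(`agree_tracks`, `exec_tracks`). Hence each commit position carries one possible message, correct
replicas generate identical checkpoints, and replies to the newest request of a client coincide.

Suppose that the request `r` of a correct client is never accepted. Then it stays the newest request
of that client, is retransmitted forever, and reaches every correct execution replica, which
forwards it. The windows of the client's request subchannel settle exactly at the counter of `r`, so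
each correct agreement replica orders `r`, unless it finds that `r` has already been agreed on
(`agree_orders`). Liveness of the black-box yields a number `s` and `fa + 1` correct replicas, each
covering `r` at `s` or stuck in a `deliver` callback.

The core is that flow control cannot deadlock (`execReaches_of_covers`). If stable execution
checkpoints are unbounded, the commit windows move arbitrarily far and every execution replica
passes `s`. Otherwise let `e₁` be the newest one. Commit windows never overtake the execution
checkpoints, so they end at `e₁ + 1`. Sends up to `e₁ + capC` therefore return, and agreement
checkpoints are bounded as well, with a newest one `s₀`. Put `m = min (s₀ + ka) (e₁ + ke)`. The `fa
+ 1` replicas cannot all reach `m`, for this would produce a newer checkpoint of one of the groups.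
A stuck replica does reach `m`: it is blocked only beyond the commit capacity or beyond `AG-WIN`,
and `ke ≤ capC`, `ka ≤ agWin`. So some replica is not stuck, covers `s` and stays below `m`. Thus `s
< m`, all `fa + 1` replicas reach `s`, their sends return, and every execution replica gets to `s`.

From then on each retransmission is answered from the stored reply. After GST these answers arrive,
and the `fe + 1` or more correct replicas make the client accept. -/

theorem fe_lt_card_correctExec (D : Deployment C Op V St) : D.fe + 1 ≤ D.correctExec.card := by
  have h := D.correctExec.card_add_card_compl
  have := D.faultyExec_card
  simp only [Fintype.card_fin] at h
  omega

theorem two_fa_lt_card_correctAgree (D : Deployment C Op V St) :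
    2 * D.fa + 1 ≤ D.correctAgree.card := by
  have h := D.correctAgree.card_add_card_compl
  have := D.faultyAgree_card
  simp only [Fintype.card_fin] at h
  omega

variable [DecidableEq C] [DecidableEq V] {D : Deployment C Op V St} {ρ : D.Run}

theorem client_step {n : ℕ} {c : C} {i} (h : ρ n = .client c i) :
    (D.state ρ (n + 1)).client c = (clientStep D.fe c ((D.state ρ n).client c) i).1 := by
  simp [state, step, h]

theorem exec_step {n : ℕ} {e} {i} (h : ρ n = .exec e i) :
    (D.state ρ (n + 1)).exec e = (execStep D.ke D.app ((D.state ρ n).exec e) i).1 := by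
  simp [state, step, h]

theorem agree_step {n : ℕ} {a} {i} (h : ρ n = .agree a i) :
    (D.state ρ (n + 1)).agree a =
      (agreeStep D.ka D.capC D.agWin ((D.state ρ n).agree a) i).1 := by
  simp [state, step, h]

theorem client_skip {n : ℕ} {c : C} (h : ∀ i, ρ n ≠ .client c i) :
    (D.state ρ (n + 1)).client c = (D.state ρ n).client c := by
  simp only [state]
  cases hn : ρ n with
  | client c' i =>
    have hne : c ≠ c' := by rintro rfl; exact h i hn
    simp [step, Function.update_of_ne hne]
  | _ => rfl

theorem exec_skip {n : ℕ} {e} (h : ∀ i, ρ n ≠ .exec e i) :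
    (D.state ρ (n + 1)).exec e = (D.state ρ n).exec e := by
  simp only [state]
  cases hn : ρ n with
  | exec e' i =>
    have hne : e ≠ e' := by rintro rfl; exact h i hn
    simp [step, Function.update_of_ne hne]
  | _ => rfl

theorem agree_skip {n : ℕ} {a} (h : ∀ i, ρ n ≠ .agree a i) :
    (D.state ρ (n + 1)).agree a = (D.state ρ n).agree a := by
  simp only [state]
  cases hn : ρ n with
  | agree a' i =>
    have hne : a ≠ a' := by rintro rfl; exact h i hn
    simp [step, Function.update_of_ne hne]
  | _ => rfl

/-- A step either hands an input to client `c` or leaves its state alone. -/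
theorem client_cases (ρ : D.Run) (n : ℕ) (c : C) :
    (∃ i, ρ n = .client c i ∧ (D.state ρ (n + 1)).client c =
      (clientStep D.fe c ((D.state ρ n).client c) i).1) ∨
    ((∀ i, ρ n ≠ .client c i) ∧
      (D.state ρ (n + 1)).client c = (D.state ρ n).client c) := by
  by_cases h : ∃ i, ρ n = .client c i
  · exact .inl (h.imp fun i hi => ⟨hi, client_step hi⟩)
  · rw [not_exists] at h
    exact .inr ⟨h, client_skip h⟩

theorem exec_cases (ρ : D.Run) (n : ℕ) (e) :
    (∃ i, ρ n = .exec e i ∧ (D.state ρ (n + 1)).exec e =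
      (execStep D.ke D.app ((D.state ρ n).exec e) i).1) ∨
    ((∀ i, ρ n ≠ .exec e i) ∧ (D.state ρ (n + 1)).exec e = (D.state ρ n).exec e) := by
  by_cases h : ∃ i, ρ n = .exec e i
  · exact .inl (h.imp fun i hi => ⟨hi, exec_step hi⟩)
  · rw [not_exists] at h
    exact .inr ⟨h, exec_skip h⟩

theorem agree_cases (ρ : D.Run) (n : ℕ) (a) :
    (∃ i, ρ n = .agree a i ∧ (D.state ρ (n + 1)).agree a =
      (agreeStep D.ka D.capC D.agWin ((D.state ρ n).agree a) i).1) ∨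
    ((∀ i, ρ n ≠ .agree a i) ∧ (D.state ρ (n + 1)).agree a = (D.state ρ n).agree a) := by
  by_cases h : ∃ i, ρ n = .agree a i
  · exact .inl (h.imp fun i hi => ⟨hi, agree_step hi⟩)
  · rw [not_exists] at h
    exact .inr ⟨h, agree_skip h⟩

/-! ## The client -/

/-- What a client has broadcast so far, relative to its current state. -/
theorem client_broadcasts (ρ : D.Run) (c : C) (n : ℕ) :
    1 ≤ ((D.state ρ n).client c).counter ∧
    (∀ r, ((D.state ρ n).client c).pending = some r →
      r.counter = ((D.state ρ n).client c).counter) ∧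
    ∀ j < n, ∀ r, D.clientDoes ρ j c (.broadcast r) →
      r.counter < ((D.state ρ n).client c).counter ∨
        ((D.state ρ n).client c).pending = some r := by
  induction n with
  | zero => exact ⟨le_rfl, by simp [state, clientInit], by simp⟩
  | succ n ih =>
    obtain ⟨h1, h2, h3⟩ := ih
    rcases client_cases ρ n c with ⟨i, hi, hs⟩ | ⟨hi, hs⟩
    · have hnow : ∀ r, D.clientDoes ρ n c (.broadcast r) →
          .broadcast r ∈ (clientStep D.fe c ((D.state ρ n).client c) i).2 := by
        rintro r ⟨i', hi', h⟩
        rw [hi] at hi'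
        cases hi'
        exact h
      rw [hs]
      generalize (D.state ρ n).client c = σ at *
      -- Every broadcast up to now is either an earlier one, classified by the induction hypothesis,
      -- or belongs to the current step.
      have key : ∀ {P : Request C Op → Prop},
          (∀ r, r.counter < σ.counter ∨ σ.pending = some r → P r) →
          (∀ r, .broadcast r ∈ (clientStep D.fe c σ i).2 → P r) →
          ∀ j < n + 1, ∀ r, D.clientDoes ρ j c (.broadcast r) → P r := by
        intro P hold hnew j hj r hr
        rcases Nat.lt_succ_iff_lt_or_eq.mp hj with hj | rfl
        · exact hold r (h3 j hj r hr)
        · exact hnew r (hnow r hr)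
      cases i with
      | issue w =>
        cases hp : σ.pending with
        | none =>
          simp only [clientStep, hp] at key ⊢
          exact ⟨h1, by simp, key (by simp +contextual) (by simp +contextual)⟩
        | some r =>
          simp only [clientStep, hp] at key h2 ⊢
          exact ⟨h1, h2, key (by simp) (by simp)⟩
      | retry =>
        cases hp : σ.pending with
        | none =>
          simp only [clientStep, hp] at key h2 ⊢
          exact ⟨h1, h2, key (by simp) (by simp)⟩
        | some r =>
          simp only [clientStep, hp] at key h2 ⊢
          exact ⟨h1, h2, key (by simp) (by simp +contextual)⟩
      | result e t v mac =>
        simp only [clientStep] at key ⊢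
        split_ifs at key ⊢ with h h'
        -- On acceptance the pending request turns into an old one: its counter is the previous
        -- value, strictly below the incremented one.
        · refine ⟨Nat.le_add_left _ _, by simp, key ?_ (by simp)⟩
          rintro r (hr | hr)
          · exact .inl (Nat.lt_succ_of_lt hr)
          · exact .inl (by rw [h2 r hr]; exact Nat.lt_succ_self _)
        · exact ⟨h1, h2, key (by simp) (by simp)⟩
        · exact ⟨h1, h2, key (by simp) (by simp)⟩
    · rw [hs]
      refine ⟨h1, h2, fun j hj r hr => ?_⟩
      rcases Nat.lt_succ_iff_lt_or_eq.mp hj with hj | rfl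
      · exact h3 j hj r hr
      · obtain ⟨i, h, -⟩ := hr
        exact absurd h (hi i)

/-- A client whose request is never answered keeps waiting for replies to it. -/
theorem client_waits {c : C} {n : ℕ} {w : Op}
    (hidle : ((D.state ρ n).client c).pending = none)
    (hissue : ρ n = .client c (.issue w))
    (hno : ∀ k > n, ∀ v, ¬ D.clientDoes ρ k c (.accept ((D.state ρ n).client c).counter v))
    {k : ℕ} (hk : n < k) :
    ((D.state ρ k).client c).counter = ((D.state ρ n).client c).counter ∧
    ((D.state ρ k).client c).pending =
      some ⟨c, ((D.state ρ n).client c).counter, w, true⟩ := by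
  induction k, hk using Nat.le_induction with
  | base =>
    rw [client_step hissue]
    simp [clientStep, hidle]
  | succ k hk ih =>
    obtain ⟨h1, h2⟩ := ih
    rcases client_cases ρ k c with ⟨i, hi, hs⟩ | ⟨hi, hs⟩
    · rw [hs]
      have hno' : ∀ v, .accept ((D.state ρ n).client c).counter v ∉
          (clientStep D.fe c ((D.state ρ k).client c) i).2 :=
        fun v hv => hno k hk v ⟨i, hi, hv⟩
      cases i with
      | issue w => simp [clientStep, h1, h2]
      | retry => simp [clientStep, h1, h2]
      | result e t v mac =>
        simp only [clientStep] at hno' ⊢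
        split_ifs at hno' ⊢ with h h'
        · exact absurd (by simp [← h1, h.2.2.1]) (hno' v)
        · exact ⟨h1, h2⟩
        · exact ⟨h1, h2⟩
    · rw [hs]
      exact ⟨h1, h2⟩

/-- The broadcasts of a client whose request is never answered. -/
theorem broadcast_of_unanswered {c : C} {n : ℕ} {w : Op}
    (hidle : ((D.state ρ n).client c).pending = none)
    (hissue : ρ n = .client c (.issue w))
    (hno : ∀ k > n, ∀ v, ¬ D.clientDoes ρ k c (.accept ((D.state ρ n).client c).counter v))
    {j : ℕ} {r : Request C Op} (hr : D.clientDoes ρ j c (.broadcast r)) :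
    r.counter < ((D.state ρ n).client c).counter ∨
      r = ⟨c, ((D.state ρ n).client c).counter, w, true⟩ := by
  obtain ⟨h1, h2⟩ := client_waits hidle hissue hno (k := max j n + 1) (by omega)
  have := (client_broadcasts ρ c (max j n + 1)).2.2 j (by omega) r hr
  rw [h1, h2] at this
  exact this.imp_right fun h => (Option.some.inj h).symm

/-- A waiting client broadcasts its request again and again, and after some time every broadcast
reaches every correct execution replica. -/
theorem write_arrives (hnet : D.PartiallySynchronous ρ) (hfair : D.FairScheduling ρ)
    {c : C} (hc : c ∈ D.correctClients) {r : Request C Op} {n : ℕ}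
    (hwait : ∀ k > n, ((D.state ρ k).client c).pending = some r)
    {e} (he : e ∈ D.correctExec) (m : ℕ) :
    ∃ k > m, ρ k = .exec e (.write r true) := by
  obtain ⟨time, gst, Δ, -, htend, hreq, -⟩ := hnet
  obtain ⟨N, hN⟩ := Filter.eventually_atTop.mp (htend.eventually_ge_atTop gst)
  -- The chosen step lies after the issue step, after GST and after `m`.
  have hlt : n < max (max N m) n + 1 := by omega
  obtain ⟨k, hk, hk' | hk'⟩ := hfair.retry c hc (max (max N m) n + 1) (by rw [hwait _ hlt]; rfl)
  · obtain ⟨j, hj, -, h⟩ := hreq c hc e he k r (hN k (by omega))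
      ⟨_, hk', by simp [clientStep, hwait k (by omega)]⟩
    exact ⟨j, by omega, h⟩
  · rw [hwait k (by omega)] at hk'
    cases hk'

/-- If every correct execution replica answers a repeatedly received request with one and the same
reply, then a waiting client accepts. -/
theorem not_waiting_of_replies (hcrypto : D.Unforgeable ρ) (hnet : D.PartiallySynchronous ρ)
    {c : C} (hc : c ∈ D.correctClients) {n t : ℕ} {w : Op} {v₀ : V}
    (ht : ((D.state ρ n).client c).counter = t)
    (hidle : ((D.state ρ n).client c).pending = none)
    (hissue : ρ n = .client c (.issue w))
    (hreply : ∀ e ∈ D.correctExec, ∀ m, ∃ k > m, D.execDoes ρ k e (.reply c t v₀))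
    (huniq : ∀ e ∈ D.correctExec, ∀ m v, D.execDoes ρ m e (.reply c t v) → v = v₀) :
    ∃ k > n, ∃ v, D.clientDoes ρ k c (.accept t v) := by
  by_contra hno
  push Not at hno
  subst ht
  have hwait := fun k (hk : n < k) => client_waits hidle hissue hno hk
  -- Storing the copy of `v₀` that completes a quorum would trigger acceptance, so without
  -- acceptance the quorum is never complete.
  have hcard : ∀ k > n, (Finset.univ.filter fun e =>
      ((D.state ρ k).client c).replies e = some v₀).card < D.fe + 1 := by
    intro k hk
    induction k, hk using Nat.le_induction with
    | base =>
      rw [client_step hissue]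
      simp [clientStep, hidle]
    | succ k hk ih =>
      rcases client_cases ρ k c with ⟨i, hi, hs⟩ | ⟨hi, hs⟩
      · rw [hs]
        have hno' : ∀ v, .accept ((D.state ρ n).client c).counter v ∉
            (clientStep D.fe c ((D.state ρ k).client c) i).2 :=
          fun v hv => hno k hk v ⟨i, hi, hv⟩
        obtain ⟨h1, h2⟩ := hwait k hk
        cases i with
        | issue w => simpa [clientStep, h2] using ih
        | retry => simpa [clientStep, h2] using ih
        | result e t v mac =>
          simp only [clientStep] at hno' ⊢
          split_ifs at hno' ⊢ with h h'
          · exact absurd (by simp [← h1, h.2.2.1]) (hno' v)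
          · by_cases hv : v = v₀
            · subst hv
              exact not_le.mp h'
            -- Storing a value other than `v₀` adds no slot that holds `v₀`.
            · refine lt_of_le_of_lt (Finset.card_le_card fun e' => ?_) ih
              simp only [Finset.mem_filter, Finset.mem_univ, true_and]
              intro he'
              by_cases hee : e' = e
              · subst hee
                simp [hv] at he'
              · rwa [Function.update_of_ne hee] at he'
          · exact ih
      · rw [hs]
        exact ih
  have hstored : ∀ e ∈ D.correctExec, ∃ m > n, ∀ k ≥ m,
      ((D.state ρ k).client c).replies e = some v₀ := by
    intro e he
    -- By unforgeability, what fills the slot of a correct replica was sent by that replica, and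
    -- `huniq` leaves only one value.
    have honly : ∀ k > n, ∀ v, ((D.state ρ k).client c).replies e = some v → v = v₀ := by
      intro k hk
      induction k, hk using Nat.le_induction with
      | base =>
        rw [client_step hissue]
        simp [clientStep, hidle]
      | succ k hk ih =>
        rcases client_cases ρ k c with ⟨i, hi, hs⟩ | ⟨hi, hs⟩
        · rw [hs]
          obtain ⟨h1, h2⟩ := hwait k hk
          cases i with
          | issue w => simpa [clientStep, h2] using ih
          | retry => simpa [clientStep, h2] using ih
          | result e' t v mac =>
            have hupd : mac = true → t = ((D.state ρ k).client c).counter → ∀ v',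
                Function.update ((D.state ρ k).client c).replies e' (some v) e = some v' →
                v' = v₀ := by
              rintro rfl rfl v' hv'
              by_cases hee : e = e'
              · subst hee
                simp only [Function.update_self, Option.some.injEq] at hv'
                subst hv'
                rw [h1] at hi
                obtain ⟨j, -, hj⟩ := hcrypto.reply_mac c hc e he k _ _ hi
                exact huniq e he j _ hj
              · rw [Function.update_of_ne hee] at hv'
                exact ih v' hv'
            simp only [clientStep]
            split_ifs with h h'
            · exact hupd h.2.1 h.2.2.1
            · exact hupd h.2.1 h.2.2.1
            · exact ih
        · rw [hs]
          exact ih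
    obtain ⟨time, gst, Δ, -, htend, -, hrep⟩ := hnet
    obtain ⟨N, hN⟩ := Filter.eventually_atTop.mp (htend.eventually_ge_atTop gst)
    -- A reply sent after GST arrives. It fills the slot unless the slot is already full, and a
    -- waiting client never empties a slot.
    obtain ⟨k, hk, hkr⟩ := hreply e he (max N n)
    obtain ⟨m, hm, -, hm'⟩ := hrep c hc e he k _ v₀ (hN k (by omega)) hkr
    have hmn : n < m := by omega
    refine ⟨m + 1, by omega, fun j hj => ?_⟩
    have hsome : (((D.state ρ j).client c).replies e).isSome = true := by
      induction j, hj using Nat.le_induction with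
      | base =>
        rw [client_step hm']
        obtain ⟨h1, h2⟩ := hwait m hmn
        simp only [clientStep, h1, h2, Option.isSome_some, true_and, Option.isNone_iff_eq_none]
        split_ifs with h h'
        · simp
        · simp
        · exact Option.isSome_iff_ne_none.mpr h
      | succ j hj ih =>
        rcases client_cases ρ j c with ⟨i, hi, hs⟩ | ⟨hi, hs⟩
        · rw [hs]
          obtain ⟨h1, h2⟩ := hwait j (by omega)
          cases i with
          | issue w => simpa [clientStep, h2] using ih
          | retry => simpa [clientStep, h2] using ih
          | result e' t v mac =>
            have hupd : (Function.update ((D.state ρ j).client c).replies e' (some v) e).isSome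
                = true := by
              by_cases hee : e = e'
              · subst hee
                simp
              · rwa [Function.update_of_ne hee]
            simp only [clientStep]
            split_ifs
            · exact hupd
            · exact hupd
            · exact ih
        · rw [hs]
          exact ih
    obtain ⟨v, hv⟩ := Option.isSome_iff_exists.mp hsome
    rw [hv, honly j (by omega) v hv]
  -- After the latest of the finitely many times `m e`, the slots of all correct replicas hold `v₀`,
  -- which contradicts `hcard`.
  choose! m hmn hm using hstored
  have hcardk := hcard (max (D.correctExec.sup m) n + 1) (by omega)
  refine absurd (D.fe_lt_card_correctExec.trans (Finset.card_le_card fun e he => ?_))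
    (not_le.mpr hcardk)
  have := Finset.le_sup (f := m) he
  simp only [Finset.mem_filter, Finset.mem_univ, true_and]
  exact hm e he _ (by omega)

end Deployment

/-! ## One step of an agreement replica -/

theorem le_foldl_max (agWin : ℕ) (l : List (CpTask C Op)) (w : ℕ) :
    w ≤ l.foldl (fun w T => max w (T.seq + agWin)) w := by
  induction l generalizing w with
  | nil => exact le_rfl
  | cons T l ih => exact (le_max_left _ _).trans (ih _)

theorem seq_add_le_foldl_max (agWin : ℕ) {l : List (CpTask C Op)} {T : CpTask C Op} (hT : T ∈ l)
    (w : ℕ) : T.seq + agWin ≤ l.foldl (fun w T => max w (T.seq + agWin)) w := by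
  induction l generalizing w with
  | nil => simp at hT
  | cons T' l ih =>
    rcases List.mem_cons.mp hT with rfl | hT
    · exact (le_max_right _ _).trans (le_foldl_max _ _ _)
    · exact ih hT _

theorem mem_settle_tasks {agWin : ℕ} {σ : AgreeState C Op} {l : List (CpTask C Op)}
    {T : CpTask C Op} : T ∈ (settle agWin σ l).tasks ↔ T ∈ l ∧ T.todo ≠ [] := by
  simp [settle]

theorem winMax_le_settle (agWin : ℕ) (σ : AgreeState C Op) (l : List (CpTask C Op)) :
    σ.winMax ≤ (settle agWin σ l).winMax :=
  le_foldl_max _ _ _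

/-- No checkpoint callback is lost: it leaves the task list only by finishing, and finishing anchors
the window. -/
theorem settle_mem_or {agWin : ℕ} (σ : AgreeState C Op) {l : List (CpTask C Op)}
    {T : CpTask C Op} (hT : T ∈ l) :
    T ∈ (settle agWin σ l).tasks ∨ T.todo = [] ∧ T.seq + agWin ≤ (settle agWin σ l).winMax := by
  by_cases h : T.todo = []
  · exact .inr ⟨h, seq_add_le_foldl_max _ (by simp [hT, h]) _⟩
  · exact .inl (mem_settle_tasks.mpr ⟨hT, h⟩)

theorem current_genCp {T : CpTask C Op} {s : ℕ} {x : AgreeCp C Op} : .genCp s x ∉ T.current := by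
  unfold CpTask.current
  split <;> simp

theorem current_commitMove {T : CpTask C Op} {p : ℕ} : .commitMove p ∉ T.current := by
  unfold CpTask.current
  split <;> simp

theorem current_gc {T : CpTask C Op} {g : ℕ} : .gc g ∉ T.current := by
  unfold CpTask.current
  split <;> simp

theorem current_commitSend {T : CpTask C Op} {p : ℕ} {x : Execute C Op}
    (h : .commitSend p x ∈ T.current) : p = x.seq ∧ x ∈ T.todo := by
  unfold CpTask.current at h
  split at h
  · simp at h
  · next heq =>
    simp only [List.mem_singleton, AgreeOut.commitSend.injEq] at h
    obtain ⟨rfl, rfl⟩ := h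
    simp [heq]

theorem mem_advance {T : CpTask C Op} {p : ℕ} {x : Execute C Op} (h : x ∈ (T.advance p).todo) :
    x ∈ T.todo := by
  unfold CpTask.advance at h
  split_ifs at h
  · exact List.mem_of_mem_tail h
  · exact h

/-! ### Effects of a single agreement handler: state changes, callback progress, emitted calls. -/

section AgreeStep

variable [DecidableEq C] {ka capC agWin : ℕ} {σ : AgreeState C Op}

theorem agreeStep_sent_fst (p : ℕ) (y : Execute C Op) :
    (agreeStep ka capC agWin σ (.sent p y)).1.tasks =
      (settle agWin σ (σ.tasks.map fun T => T.advance p)).tasks ∧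
    (agreeStep ka capC agWin σ (.sent p y)).1.winMax =
      (settle agWin σ (σ.tasks.map fun T => T.advance p)).winMax ∧
    (agreeStep ka capC agWin σ (.sent p y)).1.sn = σ.sn ∧
    (agreeStep ka capC agWin σ (.sent p y)).1.t = σ.t ∧
    (agreeStep ka capC agWin σ (.sent p y)).1.hist = σ.hist ∧
    (agreeStep ka capC agWin σ (.sent p y)).1.next = σ.next ∧
    (agreeStep ka capC agWin σ (.sent p y)).1.pos = σ.pos := by
  simp only [agreeStep]
  split
  · split
    · exact ⟨rfl, rfl, rfl, rfl, rfl, rfl, rfl⟩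
    · exact ⟨rfl, rfl, rfl, rfl, rfl, rfl, rfl⟩
  · exact ⟨rfl, rfl, rfl, rfl, rfl, rfl, rfl⟩

theorem mem_agreeStep_sent_snd {p : ℕ} {y : Execute C Op} {T : CpTask C Op} (hT : T ∈ σ.tasks)
    (hp : T.waitsFor p = true) {o : AgreeOut C Op} (ho : o ∈ (T.advance p).current) :
    o ∈ (agreeStep ka capC agWin σ (.sent p y)).2 := by
  have : o ∈ (σ.tasks.filter fun T => T.waitsFor p).flatMap fun T => (T.advance p).current :=
    List.mem_flatMap.mpr ⟨T, List.mem_filter.mpr ⟨hT, hp⟩, ho⟩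
  simp only [agreeStep]
  split
  · split_ifs
    · exact List.mem_append_right _ this
    · exact List.mem_append_right _ this
    · exact this
  · exact this

theorem sn_le_agreeStep (i : AgreeIn C Op) : σ.sn ≤ (agreeStep ka capC agWin σ i).1.sn := by
  cases i with
  | received c x => cases x <;> exact le_rfl
  | deliver s r => exact le_rfl
  | resume =>
    simp only [agreeStep]
    split
    · split_ifs
      · exact le_rfl
      · exact le_rfl
      · simp; omega
    · exact le_rfl
  | sent p y =>
    exact (agreeStep_sent_fst p y).2.2.1.ge
  | stable s x =>
    simp only [agreeStep]
    split_ifs with h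
    · exact h.le
    · exact le_rfl

theorem winMax_le_agreeStep (i : AgreeIn C Op) :
    σ.winMax ≤ (agreeStep ka capC agWin σ i).1.winMax := by
  cases i with
  | received c x => cases x <;> exact le_rfl
  | deliver s r => exact le_rfl
  | resume =>
    simp only [agreeStep]
    split
    · split_ifs <;> exact le_rfl
    · exact le_rfl
  | sent p y =>
    rw [(agreeStep_sent_fst p y).2.1]
    exact winMax_le_settle _ _ _
  | stable s x =>
    simp only [agreeStep]
    split_ifs with h
    · exact winMax_le_settle agWin
        { σ with sn := s, t := x.1, hist := x.2, next := fun c => max (σ.next c) (x.1 c + 1) } _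
    · exact le_max_left _ _

/-- The task started by a stable checkpoint. -/
def newTask (σ : AgreeState C Op) (s : ℕ) (x : AgreeCp C Op) : CpTask C Op :=
  ⟨s, x.2.filter fun m => decide (σ.sn < m.seq)⟩

/-- Where the tasks of the next state come from. -/
theorem mem_tasks_agreeStep {i : AgreeIn C Op} {T : CpTask C Op}
    (hT : T ∈ (agreeStep ka capC agWin σ i).1.tasks) :
    (T ∈ σ.tasks ∧ ∀ p y, i = .sent p y → T.waitsFor p = false) ∨
    (∃ p y T', i = .sent p y ∧ T' ∈ σ.tasks ∧ T'.waitsFor p = true ∧ T = ⟨T'.seq, T'.todo.tail⟩ ∧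
      ∀ o ∈ T.current, o ∈ (agreeStep ka capC agWin σ i).2) ∨
    (∃ s x, i = .stable s x ∧ σ.sn < s ∧ T = newTask σ s x ∧
      ∀ o ∈ T.current, o ∈ (agreeStep ka capC agWin σ i).2) := by
  cases i with
  | received c x => cases x <;> exact .inl ⟨hT, by simp⟩
  | deliver s r => exact .inl ⟨hT, by simp⟩
  | resume =>
    refine .inl ⟨?_, by simp⟩
    simp only [agreeStep] at hT
    split at hT
    · split_ifs at hT <;> exact hT
    · exact hT
  | sent p y =>
    rw [(agreeStep_sent_fst p y).1] at hT
    obtain ⟨T', hT', rfl⟩ := List.mem_map.mp (mem_settle_tasks.mp hT).1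
    by_cases hw : T'.waitsFor p = true
    · refine .inr (.inl ⟨p, y, T', rfl, hT', hw, by simp [CpTask.advance, hw], fun o ho => ?_⟩)
      exact mem_agreeStep_sent_snd hT' hw ho
    · have : T'.advance p = T' := by simp [CpTask.advance, hw]
      rw [this]
      refine .inl ⟨hT', ?_⟩
      rintro p' y' ⟨⟩
      simpa using hw
  | stable s x =>
    simp only [agreeStep] at hT ⊢
    split_ifs at hT ⊢ with h
    · rcases List.mem_cons.mp (mem_settle_tasks.mp hT).1 with rfl | hT
      · exact .inr (.inr ⟨s, x, rfl, h, rfl, fun o ho => List.mem_append_right _ ho⟩)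
      · exact .inl ⟨hT, by simp⟩
    · exact .inl ⟨hT, by simp⟩

theorem todo_ne_nil_agreeStep {i : AgreeIn C Op} (h : ∀ T ∈ σ.tasks, T.todo ≠ []) :
    ∀ T ∈ (agreeStep ka capC agWin σ i).1.tasks, T.todo ≠ [] := by
  cases i with
  | received c x => cases x <;> exact h
  | deliver s r => exact h
  | resume =>
    simp only [agreeStep]
    split
    · split_ifs <;> exact h
    · exact h
  | sent p y =>
    rw [(agreeStep_sent_fst p y).1]
    exact fun T hT => (mem_settle_tasks.mp hT).2
  | stable s x =>
    simp only [agreeStep]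
    split_ifs
    · exact fun T hT => (mem_settle_tasks.mp hT).2
    · exact h

/-- A task stays as long as its outstanding `send` call does not return. -/
theorem mem_agreeStep_tasks {i : AgreeIn C Op} {T : CpTask C Op} (hT : T ∈ σ.tasks)
    (hne : T.todo ≠ []) (hw : ∀ p y, i = .sent p y → T.waitsFor p = false) :
    T ∈ (agreeStep ka capC agWin σ i).1.tasks := by
  cases i with
  | received c x => cases x <;> exact hT
  | deliver s r => exact hT
  | resume =>
    simp only [agreeStep]
    split
    · split_ifs <;> exact hT
    · exact hT
  | sent p y =>
    rw [(agreeStep_sent_fst p y).1]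
    exact mem_settle_tasks.mpr
      ⟨List.mem_map.mpr ⟨T, hT, by simp [CpTask.advance, hw p y rfl]⟩, hne⟩
  | stable s x =>
    simp only [agreeStep]
    split_ifs
    · exact mem_settle_tasks.mpr ⟨List.mem_cons_of_mem _ hT, hne⟩
    · exact hT

theorem advance_mem_or {p : ℕ} {y : Execute C Op} {T : CpTask C Op} (hT : T ∈ σ.tasks)
    (hw : T.waitsFor p = true) :
    ⟨T.seq, T.todo.tail⟩ ∈ (agreeStep ka capC agWin σ (.sent p y)).1.tasks ∨
    T.todo.tail = [] ∧ T.seq + agWin ≤ (agreeStep ka capC agWin σ (.sent p y)).1.winMax := by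
  rw [(agreeStep_sent_fst p y).1, (agreeStep_sent_fst p y).2.1]
  exact settle_mem_or (agWin := agWin) σ (T := ⟨T.seq, T.todo.tail⟩)
    (List.mem_map.mpr ⟨T, hT, by simp [CpTask.advance, hw]⟩)

theorem newTask_mem_or {s : ℕ} {x : AgreeCp C Op} (h : σ.sn < s) :
    newTask σ s x ∈ (agreeStep ka capC agWin σ (.stable s x)).1.tasks ∨
    (newTask σ s x).todo = [] ∧
      s + agWin ≤ (agreeStep ka capC agWin σ (.stable s x)).1.winMax := by
  simp only [agreeStep, if_pos h]
  exact settle_mem_or (agWin := agWin)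
    { σ with sn := s, t := x.1, hist := x.2, next := fun c => max (σ.next c) (x.1 c + 1) }
    (T := newTask σ s x) List.mem_cons_self

theorem le_sn_agreeStep_stable {s : ℕ} {x : AgreeCp C Op} :
    s ≤ (agreeStep ka capC agWin σ (.stable s x)).1.sn := by
  simp only [agreeStep]
  split_ifs with h
  · exact le_rfl
  · exact not_lt.mp h

/-- How the sequence number, counters and history of an agreement replica change. -/
theorem agreeStep_log (i : AgreeIn C Op) :
    ((agreeStep ka capC agWin σ i).1.sn = σ.sn ∧ (agreeStep ka capC agWin σ i).1.t = σ.t ∧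
      (agreeStep ka capC agWin σ i).1.hist = σ.hist) ∨
    (∃ s r, i = .resume ∧ σ.deliv = some (.waiting s r) ∧ s ≤ σ.winMax ∧ σ.sn < s) ∨
    ∃ s x, i = .stable s x ∧ σ.sn < s ∧ (agreeStep ka capC agWin σ i).1.sn = s ∧
      (agreeStep ka capC agWin σ i).1.t = x.1 ∧ (agreeStep ka capC agWin σ i).1.hist = x.2 := by
  cases i with
  | received c x => cases x <;> exact .inl ⟨rfl, rfl, rfl⟩
  | deliver s r => exact .inl ⟨rfl, rfl, rfl⟩
  | resume =>
    cases hd : σ.deliv with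
    | none => exact .inl (by simp [agreeStep, hd])
    | some ph =>
      cases ph with
      | sending s x => exact .inl (by simp [agreeStep, hd])
      | waiting s r =>
        by_cases h1 : σ.winMax < s
        · exact .inl (by simp [agreeStep, hd, h1])
        · by_cases h2 : s ≤ σ.sn
          · exact .inl (by simp [agreeStep, hd, h1, h2])
          · exact .inr (.inl ⟨s, r, rfl, rfl, by omega, by omega⟩)
  | sent p y =>
    obtain ⟨-, -, h1, h2, h3, -, -⟩ := agreeStep_sent_fst (ka := ka) (capC := capC) (agWin := agWin)
      (σ := σ) p y
    exact .inl ⟨h1, h2, h3⟩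
  | stable s x =>
    simp only [agreeStep]
    split_ifs with h
    · exact .inr (.inr ⟨s, x, rfl, h, rfl, rfl, rfl⟩)
    · exact .inl ⟨rfl, rfl, rfl⟩

/-- This is the only transition in which a replica extends the log by itself; every other change of
`sn` adopts a checkpoint. -/
theorem agreeStep_resume {s : ℕ} {r : Request C Op} (hd : σ.deliv = some (.waiting s r))
    (hw : s ≤ σ.winMax) (hs : σ.sn < s) :
    agreeStep ka capC agWin σ .resume =
      ({ σ with
          sn := s
          t := Function.update σ.t r.client (max (σ.t r.client) r.counter)
          next := Function.update σ.next r.client (max (σ.next r.client) (r.counter + 1))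
          hist := pushHist capC σ.hist ⟨r, s⟩
          deliv := some (.sending s
            (Function.update σ.t r.client (max (σ.t r.client) r.counter),
              pushHist capC σ.hist ⟨r, s⟩)) },
        [.commitSend s ⟨r, s⟩]) := by
  simp only [agreeStep, hd, if_neg (not_lt.mpr hw), if_neg (not_le.mpr hs)]

/-- How the `deliver` callback progresses. -/
theorem agreeStep_deliv (i : AgreeIn C Op) :
    ((agreeStep ka capC agWin σ i).1.deliv = σ.deliv ∧
      (∀ p y x, i = .sent p y → σ.deliv ≠ some (.sending p x)) ∧
      ∀ s r, i = .resume → σ.deliv = some (.waiting s r) → σ.winMax < s) ∨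
    (∃ s r, i = .deliver s r ∧ (agreeStep ka capC agWin σ i).1.deliv = some (.waiting s r)) ∨
    (∃ s r, i = .resume ∧ σ.deliv = some (.waiting s r) ∧ s ≤ σ.sn ∧
      (agreeStep ka capC agWin σ i).1.deliv = none) ∨
    (∃ s r, i = .resume ∧ σ.deliv = some (.waiting s r) ∧ s ≤ σ.winMax ∧ σ.sn < s) ∨
    ∃ s y x, i = .sent s y ∧ σ.deliv = some (.sending s x) ∧
      (agreeStep ka capC agWin σ i).1.deliv = none ∧
      (s % ka = 0 → .genCp s x ∈ (agreeStep ka capC agWin σ i).2) := by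
  cases i with
  | received c x => cases x <;> exact .inl ⟨rfl, by simp, by simp⟩
  | deliver s r => exact .inr (.inl ⟨s, r, rfl, rfl⟩)
  | resume =>
    cases hd : σ.deliv with
    | none => exact .inl ⟨by simp [agreeStep, hd], by simp, by simp⟩
    | some ph =>
      cases ph with
      | sending s x => exact .inl ⟨by simp [agreeStep, hd], by simp, by simp⟩
      | waiting s r =>
        by_cases h1 : σ.winMax < s
        · refine .inl ⟨by simp [agreeStep, hd, h1], by simp, ?_⟩
          rintro s' r' - ⟨⟩
          exact h1
        · by_cases h2 : s ≤ σ.sn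
          · exact .inr (.inr (.inl ⟨s, r, rfl, rfl, h2, by simp [agreeStep, hd, h1, h2]⟩))
          · exact .inr (.inr (.inr (.inl ⟨s, r, rfl, rfl, by omega, by omega⟩)))
  | sent p y =>
    cases hd : σ.deliv with
    | none => exact .inl ⟨by simp [agreeStep, hd, settle], by simp, by simp⟩
    | some ph =>
      cases ph with
      | waiting s x => exact .inl ⟨by simp [agreeStep, hd, settle], by simp, by simp⟩
      | sending s x =>
        by_cases h : s = p
        · subst h
          refine .inr (.inr (.inr (.inr ⟨s, y, x, rfl, rfl, by simp [agreeStep, hd], ?_⟩)))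
          intro h0
          simp [agreeStep, hd, h0]
        · refine .inl ⟨by simp [agreeStep, hd, h, settle], ?_, by simp⟩
          rintro p' y' x' ⟨⟩ ⟨⟩
          exact h rfl
  | stable s x =>
    refine .inl ⟨?_, by simp, by simp⟩
    simp only [agreeStep]
    split_ifs <;> rfl

/-- Which inputs cause which calls. -/
theorem mem_agreeStep {i : AgreeIn C Op} {o : AgreeOut C Op}
    (ho : o ∈ (agreeStep ka capC agWin σ i).2) :
    (∃ c r, i = .received c (.msg r) ∧ o = .order r) ∨
    (∃ s r, i = .resume ∧ σ.deliv = some (.waiting s r) ∧ s ≤ σ.winMax ∧ σ.sn < s ∧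
      o = .commitSend s ⟨r, s⟩) ∨
    (∃ s y x, i = .sent s y ∧ σ.deliv = some (.sending s x) ∧ s % ka = 0 ∧ o = .genCp s x) ∨
    (∃ p y, i = .sent p y ∧ ∃ T ∈ σ.tasks, o ∈ (T.advance p).current) ∨
    ∃ s x, i = .stable s x ∧ (o = .commitMove (s + 1 - x.2.length) ∨ o = .gc (s + 1) ∨
      σ.sn < s ∧ o ∈ (newTask σ s x).current) := by
  cases i with
  | received c x =>
    cases x with
    | msg r => exact .inl ⟨c, r, rfl, by simpa [agreeStep] using ho⟩
    | tooOld p => simp [agreeStep] at ho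
  | deliver s r => simp [agreeStep] at ho
  | resume =>
    simp only [agreeStep] at ho
    split at ho
    · split_ifs at ho
      · simp at ho
      · simp at ho
      · exact .inr (.inl ⟨_, _, rfl, by assumption, by omega, by omega, by simpa using ho⟩)
    · simp at ho
  | sent p y =>
    have houts : o ∈ ((σ.tasks.filter fun T => T.waitsFor p).flatMap
        fun T => (T.advance p).current) → ∃ T ∈ σ.tasks, o ∈ (T.advance p).current := by
      intro h
      obtain ⟨T, hT, h⟩ := List.mem_flatMap.mp h
      exact ⟨T, (List.mem_filter.mp hT).1, h⟩
    simp only [agreeStep] at ho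
    split at ho
    · next s x hd =>
      split_ifs at ho with h1 h2
      · subst h1
        rcases List.mem_append.mp ho with ho | ho
        · exact .inr (.inr (.inl ⟨_, _, _, rfl, hd, h2, by simpa using ho⟩))
        · exact .inr (.inr (.inr (.inl ⟨_, _, rfl, houts ho⟩)))
      · exact .inr (.inr (.inr (.inl ⟨_, _, rfl, houts (by simpa using ho)⟩)))
      · exact .inr (.inr (.inr (.inl ⟨_, _, rfl, houts ho⟩)))
    · exact .inr (.inr (.inr (.inl ⟨_, _, rfl, houts ho⟩)))
  | stable s x =>
    refine .inr (.inr (.inr (.inr ⟨s, x, rfl, ?_⟩)))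
    simp only [agreeStep] at ho
    split_ifs at ho with h
    · rcases List.mem_append.mp ho with ho | ho
      · simp only [List.mem_cons, List.not_mem_nil, or_false] at ho
        exact ho.elim .inl fun ho => .inr (.inl ho)
      · exact .inr (.inr ⟨h, ho⟩)
    · simp only [List.mem_cons, List.not_mem_nil, or_false] at ho
      exact ho.elim .inl fun ho => .inr (.inl ho)

/-- This couples checkpoints to flow control: one for `s` exists only after a commit-channel `send`
at `s` has returned, so agreement checkpoints cannot run ahead of the commit windows. The content is
the one frozen in the `sending` phase, even if the replica has moved on. -/
theorem genCp_mem_agreeStep {i : AgreeIn C Op} {s : ℕ} {x : AgreeCp C Op}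
    (h : .genCp s x ∈ (agreeStep ka capC agWin σ i).2) :
    ∃ y, i = .sent s y ∧ σ.deliv = some (.sending s x) ∧ s % ka = 0 := by
  rcases mem_agreeStep h with ⟨c, r, -, h⟩ | ⟨s', r, -, -, -, -, h⟩ | ⟨s', y, x', hi, hd, hk, h⟩ |
    ⟨p, y, -, T, -, h⟩ | ⟨s', x', -, h | h | ⟨-, h⟩⟩
  · cases h
  · cases h
  · cases h
    exact ⟨y, hi, hd, hk⟩
  · exact absurd h current_genCp
  · cases h
  · cases h
  · exact absurd h current_genCp

theorem commitMove_mem_agreeStep {i : AgreeIn C Op} {p : ℕ}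
    (h : .commitMove p ∈ (agreeStep ka capC agWin σ i).2) :
    ∃ s x, i = .stable s x ∧ p = s + 1 - x.2.length := by
  rcases mem_agreeStep h with ⟨c, r, -, h⟩ | ⟨s', r, -, -, -, -, h⟩ | ⟨s', y, x', hi, hd, hk, h⟩ |
    ⟨p, y, -, T, -, h⟩ | ⟨s', x', hi, h | h | ⟨-, h⟩⟩
  · cases h
  · cases h
  · cases h
  · exact absurd h current_commitMove
  · cases h
    exact ⟨s', x', hi, rfl⟩
  · cases h
  · exact absurd h current_commitMove

theorem gc_mem_agreeStep {i : AgreeIn C Op} {g : ℕ}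
    (h : .gc g ∈ (agreeStep ka capC agWin σ i).2) :
    ∃ s x, i = .stable s x ∧ g = s + 1 := by
  rcases mem_agreeStep h with ⟨c, r, -, h⟩ | ⟨s', r, -, -, -, -, h⟩ | ⟨s', y, x', hi, hd, hk, h⟩ |
    ⟨p, y, -, T, -, h⟩ | ⟨s', x', hi, h | h | ⟨-, h⟩⟩
  · cases h
  · cases h
  · cases h
  · exact absurd h current_gc
  · cases h
  · cases h
    exact ⟨s', x', hi, rfl⟩
  · exact absurd h current_gc

theorem commitSend_mem_agreeStep {i : AgreeIn C Op} {p : ℕ} {x : Execute C Op}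
    (h : .commitSend p x ∈ (agreeStep ka capC agWin σ i).2) :
    (∃ r, σ.deliv = some (.waiting p r) ∧ x = ⟨r, p⟩) ∨
    p = x.seq ∧ ((∃ T ∈ σ.tasks, x ∈ T.todo) ∨ ∃ s y, i = .stable s y ∧ x ∈ y.2) := by
  rcases mem_agreeStep h with ⟨c, r, -, h⟩ | ⟨s', r, -, hd, -, -, h⟩ | ⟨s', y, x', hi, hd, hk, h⟩ |
    ⟨p, y, -, T, hT, h⟩ | ⟨s', x', hi, h | h | ⟨-, h⟩⟩
  · cases h
  · cases h
    exact .inl ⟨r, hd, rfl⟩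
  · cases h
  · obtain ⟨h1, h2⟩ := current_commitSend h
    exact .inr ⟨h1, .inl ⟨T, hT, mem_advance h2⟩⟩
  · cases h
  · cases h
  · obtain ⟨h1, h2⟩ := current_commitSend h
    exact .inr ⟨h1, .inr ⟨s', x', hi, (List.mem_filter.mp h2).1⟩⟩

end AgreeStep

/-! ## The agreed log -/

/-- The state of an agreement replica that has processed the first `s` requests of the log `R`. -/
def agreeLog [DecidableEq C] (cap : ℕ) (R : ℕ → Request C Op) : ℕ → AgreeCp C Op
  | 0 => (fun _ => 0, [])
  | s + 1 =>
    (Function.update (agreeLog cap R s).1 (R (s + 1)).client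
      (max ((agreeLog cap R s).1 (R (s + 1)).client) (R (s + 1)).counter),
      pushHist cap (agreeLog cap R s).2 ⟨R (s + 1), s + 1⟩)

section AgreeLog

variable [DecidableEq C] {cap : ℕ} {R : ℕ → Request C Op}

theorem agreeLog_hist (s : ℕ) : (agreeLog cap R s).2 =
    ((List.range s).map fun i => (⟨R (i + 1), i + 1⟩ : Execute C Op)).drop (s - cap) := by
  induction s with
  | zero => simp [agreeLog]
  | succ s ih =>
    simp only [agreeLog, ih, pushHist, List.range_succ, List.map_append, List.map_cons, List.map_nil]
    -- As `s - cap ≤ s`, the new entry can be moved under the first `drop`; the two drops then add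
    -- up to `s + 1 - cap`.
    rw [← List.drop_append_of_le_length (by simp), List.drop_drop]
    congr 1
    simp
    omega

theorem agreeLog_hist_length (s : ℕ) : (agreeLog cap R s).2.length = min s cap := by
  rw [agreeLog_hist]
  simp
  omega

theorem mem_agreeLog_hist {s : ℕ} {x : Execute C Op} (h : x ∈ (agreeLog cap R s).2) :
    x = ⟨R x.seq, x.seq⟩ ∧ x.seq ≤ s := by
  rw [agreeLog_hist] at h
  obtain ⟨i, hi, rfl⟩ := List.mem_map.mp (List.mem_of_mem_drop h)
  exact ⟨rfl, List.mem_range.mp hi⟩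

theorem agreeLog_hist_mem {s m : ℕ} (h1 : 1 ≤ m) (h2 : m ≤ s) (h3 : s < m + cap) :
    (⟨R m, m⟩ : Execute C Op) ∈ (agreeLog cap R s).2 := by
  obtain ⟨m, rfl⟩ := Nat.exists_eq_add_of_le' h1
  rw [agreeLog_hist, List.mem_iff_getElem]
  refine ⟨m - (s - cap), by simp; omega, ?_⟩
  have : s - cap + (m - (s - cap)) = m := by omega
  simp [this]

theorem agreeLog_counter_le {c : C} {t : ℕ} (h : ∀ i, (R i).client = c → (R i).counter ≤ t)
    (s : ℕ) : (agreeLog cap R s).1 c ≤ t := by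
  induction s with
  | zero => exact Nat.zero_le _
  | succ s ih =>
    simp only [agreeLog, Function.update_apply]
    split_ifs with hc
    · subst hc
      exact max_le ih (h _ rfl)
    · exact ih

/-- The counter vector is a running maximum, so a positive value is attained by an entry of the log.
A replica that learns of a counter from a checkpoint thereby finds the request itself at a sequence
number the checkpoint covers. -/
theorem exists_of_agreeLog_counter {c : C} {t : ℕ} (ht : 1 ≤ t) {s : ℕ}
    (h : (agreeLog cap R s).1 c = t) : ∃ i ≤ s, (R i).client = c ∧ (R i).counter = t := by
  induction s with
  | zero =>
    simp only [agreeLog] at h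
    omega
  | succ s ih =>
    simp only [agreeLog, Function.update_apply] at h
    split_ifs at h with hc
    · rw [← hc] at h
      rcases max_choice ((agreeLog cap R s).1 c) (R (s + 1)).counter with hm | hm
      · rw [hm] at h
        exact (ih h).imp fun i hi => ⟨hi.1.trans (Nat.le_succ s), hi.2⟩
      · rw [hm] at h
        exact ⟨s + 1, le_rfl, hc.symm, h⟩
    · exact (ih h).imp fun i hi => ⟨hi.1.trans (Nat.le_succ s), hi.2⟩

end AgreeLog

/-! ## Agreement replicas follow the agreed log -/

/-- The state of an agreement replica is determined by the log `R` and its sequence number. -/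
structure AgreeState.Tracks [DecidableEq C] (cap : ℕ) (R : ℕ → Request C Op)
    (σ : AgreeState C Op) : Prop where
  log : (σ.t, σ.hist) = agreeLog cap R σ.sn
  waiting : ∀ s r, σ.deliv = some (.waiting s r) → r = R s ∧ 1 ≤ s ∧ s ≤ σ.sn + 1
  sending : ∀ s x, σ.deliv = some (.sending s x) → x = agreeLog cap R s ∧ s ≤ σ.sn
  todo_ne : ∀ T ∈ σ.tasks, T.todo ≠ []
  todo : ∀ T ∈ σ.tasks, ∀ m ∈ T.todo, m = ⟨R m.seq, m.seq⟩ ∧ m.seq ≤ T.seq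

/-- A waiting position is at most `sn + 1`, so one that has not been skipped is exactly the next,
and the handler computes one recursion step of `agreeLog`. -/
theorem agreeLog_of_resume [DecidableEq C] {cap : ℕ} {R : ℕ → Request C Op}
    {σ : AgreeState C Op} (h : σ.Tracks cap R) {s : ℕ} {r : Request C Op}
    (hd : σ.deliv = some (.waiting s r)) (hs : σ.sn < s) :
    (Function.update σ.t r.client (max (σ.t r.client) r.counter), pushHist cap σ.hist ⟨r, s⟩) =
      agreeLog cap R s := by
  obtain ⟨rfl, -, h2⟩ := h.waiting s r hd
  obtain rfl : s = σ.sn + 1 := by omega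
  have := h.log
  simp only [agreeLog, ← this]

theorem AgreeState.Tracks.step [DecidableEq C] {ka cap agWin : ℕ} {R : ℕ → Request C Op}
    {σ : AgreeState C Op} (h : σ.Tracks cap R) {i : AgreeIn C Op}
    (hdel : ∀ s r, i = .deliver s r → r = R s ∧ 1 ≤ s ∧ s ≤ σ.sn + 1)
    (hst : ∀ s x, i = .stable s x → x = agreeLog cap R s) :
    (agreeStep ka cap agWin σ i).1.Tracks cap R where
  log := by
    rcases agreeStep_log (ka := ka) (capC := cap) (agWin := agWin) (σ := σ) i with
      ⟨h1, h2, h3⟩ | ⟨s, r, rfl, hd, hw, hs⟩ | ⟨s, x, rfl, -, h1, h2, h3⟩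
    · rw [h1, h2, h3, h.log]
    · rw [agreeStep_resume hd hw hs]
      exact agreeLog_of_resume h hd hs
    · rw [h1, h2, h3, ← hst s x rfl]
  waiting := by
    intro s r hsr
    have hle := sn_le_agreeStep (ka := ka) (capC := cap) (agWin := agWin) (σ := σ) i
    rcases agreeStep_deliv (ka := ka) (capC := cap) (agWin := agWin) (σ := σ) i with
      ⟨h1, -⟩ | ⟨s', r', hi, h1⟩ | ⟨s', r', -, -, -, h1⟩ | ⟨s', r', rfl, hd, hw, hs⟩ |
      ⟨s', y, x, -, -, h1, -⟩
    · obtain ⟨h1, h2, h3⟩ := h.waiting s r (h1 ▸ hsr)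
      exact ⟨h1, h2, by omega⟩
    · rw [h1] at hsr
      cases hsr
      obtain ⟨h1, h2, h3⟩ := hdel s r hi
      exact ⟨h1, h2, by omega⟩
    · rw [h1] at hsr
      cases hsr
    · rw [agreeStep_resume hd hw hs] at hsr
      cases hsr
    · rw [h1] at hsr
      cases hsr
  sending := by
    intro s z hsr
    have hle := sn_le_agreeStep (ka := ka) (capC := cap) (agWin := agWin) (σ := σ) i
    rcases agreeStep_deliv (ka := ka) (capC := cap) (agWin := agWin) (σ := σ) i with
      ⟨h1, -⟩ | ⟨s', r', hi, h1⟩ | ⟨s', r', -, -, -, h1⟩ | ⟨s', r', rfl, hd, hw, hs⟩ |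
      ⟨s', y, x, -, -, h1, -⟩
    · obtain ⟨h1, h2⟩ := h.sending s z (h1 ▸ hsr)
      exact ⟨h1, by omega⟩
    · rw [h1] at hsr
      cases hsr
    · rw [h1] at hsr
      cases hsr
    · rw [agreeStep_resume hd hw hs] at hsr ⊢
      cases hsr
      exact ⟨agreeLog_of_resume h hd hs, le_rfl⟩
    · rw [h1] at hsr
      cases hsr
  todo_ne := todo_ne_nil_agreeStep h.todo_ne
  todo := by
    intro T hT m hm
    rcases mem_tasks_agreeStep hT with ⟨hT, -⟩ | ⟨p, y, T', -, hT', -, rfl, -⟩ |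
      ⟨s, x, hi, -, rfl, -⟩
    · exact h.todo T hT m hm
    · exact h.todo T' hT' m (List.mem_of_mem_tail hm)
    · have := (List.mem_filter.mp hm).1
      rw [hst s x hi] at this
      exact mem_agreeLog_hist this

namespace Deployment

variable [DecidableEq C] [DecidableEq V] {D : Deployment C Op V St} {ρ : D.Run}

/-- The correct agreement replicas are only delivered requests of the log `R`. -/
def IsLog (D : Deployment C Op V St) (ρ : D.Run) (R : ℕ → Request C Op) : Prop :=
  ∀ a ∈ D.correctAgree, ∀ n s r, D.Delivers ρ n a s r → r = R s

/-! ### Monotonicity along a run, and correctness of agreement states with respect to the log. -/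

theorem agree_sn_mono (ρ : D.Run) (a) : Monotone fun n => ((D.state ρ n).agree a).sn := by
  refine monotone_nat_of_le_succ fun n => ?_
  rcases agree_cases ρ n a with ⟨i, -, hs⟩ | ⟨-, hs⟩
  · rw [hs]
    exact sn_le_agreeStep i
  · rw [hs]

theorem agree_winMax_mono (ρ : D.Run) (a) :
    Monotone fun n => ((D.state ρ n).agree a).winMax := by
  refine monotone_nat_of_le_succ fun n => ?_
  rcases agree_cases ρ n a with ⟨i, -, hs⟩ | ⟨-, hs⟩
  · rw [hs]
    exact winMax_le_agreeStep i
  · rw [hs]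

theorem le_agree_sn_of_stable {n a s x} (h : ρ n = .agree a (.stable s x)) :
    s ≤ ((D.state ρ (n + 1)).agree a).sn := by
  rw [agree_step h]
  exact le_sn_agreeStep_stable

/-- Garbage collection happens only in `stable_cp`, which also brings `sn` to the checkpoint.
Skipped numbers are therefore always reflected in `sn`. -/
theorem gc_le_sn {j n a g} (h : D.agreeDoes ρ j a (.gc g)) (hj : j < n) :
    g ≤ ((D.state ρ n).agree a).sn + 1 := by
  obtain ⟨i, hi, h⟩ := h
  obtain ⟨s, x, rfl, rfl⟩ := gc_mem_agreeStep h
  exact Nat.succ_le_succ ((le_agree_sn_of_stable hi).trans (agree_sn_mono ρ a hj))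

/-- A sleeping callback is left only by processing its number or by finding it already skipped. A
further `deliver` cannot overwrite it, because the black-box waits for the callback to return. -/
theorem delivered_le_sn (hagree : D.IsAgreement ρ) {a} (ha : a ∈ D.correctAgree) {j s r}
    (h : D.Delivers ρ j a s r) {n : ℕ} (hj : j < n) :
    s ≤ ((D.state ρ n).agree a).sn ∨ ((D.state ρ n).agree a).deliv = some (.waiting s r) := by
  induction n, hj using Nat.le_induction with
  | base =>
    right
    rw [agree_step h]
    rfl
  | succ n hn ih =>
    rcases ih with ih | ih
    · exact .inl (ih.trans (agree_sn_mono ρ a (Nat.le_succ n)))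
    · rcases agree_cases ρ n a with ⟨i, hi, hs⟩ | ⟨-, hs⟩
      · rcases agreeStep_deliv (ka := D.ka) (capC := D.capC) (agWin := D.agWin)
          (σ := (D.state ρ n).agree a) i with
          ⟨h1, -⟩ | ⟨s', r', rfl, h1⟩ | ⟨s', r', -, hd, hle, h1⟩ | ⟨s', r', rfl, hd, hw, hlt⟩ |
          ⟨s', y, x, -, hd, h1, -⟩
        · exact .inr (by rw [hs, h1, ih])
        · have := hagree.blocking a ha n s' r' hi
          rw [ih] at this
          cases this
        · rw [ih] at hd
          cases hd
          exact .inl (hle.trans (agree_sn_mono ρ a (Nat.le_succ n)))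
        · rw [ih] at hd
          cases hd
          left
          rw [hs, agreeStep_resume ih hw hlt]
        · rw [ih] at hd
          cases hd
      · exact .inr (by rw [hs, ih])

/-- Black-box deliveries have no gaps with respect to the local sequence number. -/
theorem delivers_le_succ_sn (hagree : D.IsAgreement ρ) {a} (ha : a ∈ D.correctAgree) {n s r}
    (h : D.Delivers ρ n a s r) : 1 ≤ s ∧ s ≤ ((D.state ρ n).agree a).sn + 1 := by
  obtain ⟨h1, h2⟩ := hagree.order a ha n s r h
  refine ⟨h1, ?_⟩
  by_cases hs : s = 1
  · omega
  -- The predecessor `s - 1` was delivered or collected earlier. If delivered, its callback is over,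
  -- since none is in progress at a delivery. Either way `sn` has reached `s - 1`.
  rcases h2 (s - 1) (by omega) (by omega) with ⟨j, hj, r', hr'⟩ | ⟨j, hj, g, hg, hgc⟩
  · rcases delivered_le_sn hagree ha hr' hj with h' | h'
    · omega
    · rw [hagree.blocking a ha n s r h] at h'
      cases h'
  · have := gc_le_sn hgc hj
    omega

/-- The induction runs over time for all replicas at once: an adopted checkpoint was generated
strictly earlier by a correct replica, which followed the log by the induction hypothesis. -/
theorem agree_tracks (hagree : D.IsAgreement ρ)
    (hcp : (D.agreeCheckpoints ρ).IsCheckpoint D.correctAgree D.fa)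
    {R : ℕ → Request C Op} (hR : D.IsLog ρ R) {a} (ha : a ∈ D.correctAgree) (n : ℕ) :
    ((D.state ρ n).agree a).Tracks D.capC R := by
  induction n using Nat.strong_induction_on generalizing a with
  | _ n ih =>
    cases n with
    | zero =>
      exact ⟨rfl, by simp [state, agreeInit], by simp [state, agreeInit],
        by simp [state, agreeInit], by simp [state, agreeInit]⟩
    | succ n =>
      rcases agree_cases ρ n a with ⟨i, hi, hs⟩ | ⟨-, hs⟩
      · rw [hs]
        refine (ih n (Nat.lt_succ_self n) ha).step ?_ ?_
        · rintro s r rfl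
          exact ⟨hR a ha n s r hi, delivers_le_succ_sn hagree ha hi⟩
        · rintro s x rfl
          obtain ⟨a', ha', j, hj, i', -, hgen⟩ := hcp.safety a ha n s x hi
          obtain ⟨y, -, hd, -⟩ := genCp_mem_agreeStep hgen
          exact ((ih j (by omega) ha').sending s x hd).1
      · rw [hs]
        exact ih n (Nat.lt_succ_self n) ha

theorem agree_stable_eq (hagree : D.IsAgreement ρ)
    (hcp : (D.agreeCheckpoints ρ).IsCheckpoint D.correctAgree D.fa)
    {R : ℕ → Request C Op} (hR : D.IsLog ρ R) {a} (ha : a ∈ D.correctAgree) {n s x}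
    (h : ρ n = .agree a (.stable s x)) : x = agreeLog D.capC R s := by
  obtain ⟨a', ha', j, hj, i', -, hgen⟩ := hcp.safety a ha n s x h
  obtain ⟨y, -, hd, -⟩ := genCp_mem_agreeStep hgen
  exact ((agree_tracks hagree hcp hR ha' j).sending s x hd).1

/-- The position determines the message, whether it comes from a `deliver` callback or from the
history of a checkpoint. This makes the messages of different correct replicas equal, as channel
property (I) requires. -/
theorem commitSend_eq (hagree : D.IsAgreement ρ)
    (hcp : (D.agreeCheckpoints ρ).IsCheckpoint D.correctAgree D.fa)
    {R : ℕ → Request C Op} (hR : D.IsLog ρ R) {a} (ha : a ∈ D.correctAgree) {n p x}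
    (h : D.agreeDoes ρ n a (.commitSend p x)) : x = ⟨R p, p⟩ := by
  obtain ⟨i, hi, h⟩ := h
  have htr := agree_tracks hagree hcp hR ha n
  rcases commitSend_mem_agreeStep h with ⟨r, hd, rfl⟩ | ⟨rfl, ⟨T, hT, hx⟩ | ⟨s, y, rfl, hx⟩⟩
  · rw [(htr.waiting p r hd).1]
  · exact (htr.todo T hT x hx).1
  · rw [agree_stable_eq hagree hcp hR ha hi] at hx
    exact (mem_agreeLog_hist hx).1

/-! ## Outstanding `send` calls on the commit channel -/

/-- Replica `a` has called `send` at position `p`, and this call has not returned before `n`. -/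
def Outstanding (D : Deployment C Op V St) (ρ : D.Run) (n : ℕ) (a : Fin (3 * D.fa + 1)) (p : ℕ) :
    Prop :=
  ∃ j < n, ∃ x, D.agreeDoes ρ j a (.commitSend p x) ∧
    ∀ k, j < k → k < n → ∀ y, ρ k ≠ .agree a (.sent p y)

theorem Outstanding.succ {n a p} (h : D.Outstanding ρ n a p)
    (hn : ∀ y, ρ n ≠ .agree a (.sent p y)) : D.Outstanding ρ (n + 1) a p := by
  obtain ⟨j, hj, x, hx, hk⟩ := h
  refine ⟨j, by omega, x, hx, fun k hjk hkn => ?_⟩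
  rcases Nat.lt_succ_iff_lt_or_eq.mp hkn with hkn | rfl
  · exact hk k hjk hkn
  · exact hn

theorem outstanding_of_send {n a p x} (h : D.agreeDoes ρ n a (.commitSend p x)) :
    D.Outstanding ρ (n + 1) a p :=
  ⟨n, by omega, x, h, fun k h1 h2 => by omega⟩

/-- The phase is entered together with the call and left at the first return for that position, so
it persists exactly while the call is outstanding. -/
theorem outstanding_of_sending {n a s x}
    (h : ((D.state ρ n).agree a).deliv = some (.sending s x)) : D.Outstanding ρ n a s := by
  induction n generalizing s x with
  | zero => simp [state, agreeInit] at h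
  | succ n ih =>
    rcases agree_cases ρ n a with ⟨i, hi, hs⟩ | ⟨hi, hs⟩
    · rw [hs] at h
      rcases agreeStep_deliv (ka := D.ka) (capC := D.capC) (agWin := D.agWin)
          (σ := (D.state ρ n).agree a) i with
          ⟨h1, h2, -⟩ | ⟨s', r', rfl, h1⟩ | ⟨s', r', -, hd, hle, h1⟩ | ⟨s', r', rfl, hd, hw, hlt⟩ |
          ⟨s', y, x, -, hd, h1, -⟩
      · rw [h1] at h
        refine (ih h).succ fun y hy => ?_
        rw [hi] at hy
        cases hy
        exact h2 s y x rfl h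
      · rw [h1] at h
        cases h
      · rw [h1] at h
        cases h
      · rw [agreeStep_resume hd hw hlt] at h
        cases h
        exact outstanding_of_send (x := ⟨r', s⟩)
          ⟨_, hi, by rw [agreeStep_resume hd hw hlt]; exact List.mem_singleton_self _⟩
      · rw [h1] at h
        cases h
    · rw [hs] at h
      exact (ih h).succ fun y => hi _

theorem outstanding_of_task {n a} {T : CpTask C Op} (hT : T ∈ ((D.state ρ n).agree a).tasks)
    {x l} (hx : T.todo = x :: l) : D.Outstanding ρ n a x.seq := by
  induction n generalizing T l with
  | zero => simp [state, agreeInit] at hT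
  | succ n ih =>
    have hcur : .commitSend x.seq x ∈ T.current := by simp [CpTask.current, hx]
    rcases agree_cases ρ n a with ⟨i, hi, hs⟩ | ⟨hi, hs⟩
    · rw [hs] at hT
      rcases mem_tasks_agreeStep hT with ⟨hT, hw⟩ | ⟨p, y, T', rfl, hT', -, -, hout⟩ |
        ⟨s, y, rfl, -, -, hout⟩
      · refine (ih hT hx).succ fun y hy => ?_
        rw [hi] at hy
        cases hy
        have := hw _ y rfl
        simp [CpTask.waitsFor, hx] at this
      · exact outstanding_of_send ⟨_, hi, hout _ hcur⟩
      · exact outstanding_of_send ⟨_, hi, hout _ hcur⟩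
    · rw [hs] at hT
      exact (ih hT hx).succ fun y => hi _

/-- All `send` calls of correct replicas at positions up to `q` of the commit channel return. -/
def SendsReturn (D : Deployment C Op V St) (ρ : D.Run) (q : ℕ) : Prop :=
  ∀ a ∈ D.correctAgree, ∀ n p x, p ≤ q → D.agreeDoes ρ n a (.commitSend p x) →
    ∃ j > n, ρ j = .agree a (.sent p x)

theorem SendsReturn.mono {q q' : ℕ} (h : D.SendsReturn ρ q) (hq : q' ≤ q) : D.SendsReturn ρ q' :=
  fun a ha n p x hp => h a ha n p x (hp.trans hq)

/-- The first return of an outstanding `send` call. -/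
theorem Outstanding.returns {q n a p} (h : D.Outstanding ρ n a p) (hq : D.SendsReturn ρ q)
    (ha : a ∈ D.correctAgree) (hp : p ≤ q) :
    ∃ j ≥ n, (∃ y, ρ j = .agree a (.sent p y)) ∧
      ∀ k, n ≤ k → k < j → ∀ y, ρ k ≠ .agree a (.sent p y) := by
  classical
  obtain ⟨j, hj, x, hx, hk⟩ := h
  obtain ⟨j', hj', hr⟩ := hq a ha j p x hp hx
  -- The promised return follows the call at `j`; it cannot precede `n`, because the call is still
  -- outstanding then.
  have hex : ∃ m, n ≤ m ∧ ∃ y, ρ m = .agree a (.sent p y) := by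
    refine ⟨j', ?_, x, hr⟩
    by_contra hlt
    exact hk j' hj' (not_le.mp hlt) x hr
  refine ⟨Nat.find hex, (Nat.find_spec hex).1, (Nat.find_spec hex).2, fun k h1 h2 y hy => ?_⟩
  exact Nat.find_min hex h2 ⟨h1, y, hy⟩

/-- A `stable_cp` callback all of whose `send` calls return sends everything and then anchors the
window. -/
theorem task_completes (hagree : D.IsAgreement ρ)
    (hcp : (D.agreeCheckpoints ρ).IsCheckpoint D.correctAgree D.fa)
    {R : ℕ → Request C Op} (hR : D.IsLog ρ R) {a} (ha : a ∈ D.correctAgree) {q : ℕ}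
    (hq : D.SendsReturn ρ q) {n : ℕ} {T : CpTask C Op}
    (hT : T ∈ ((D.state ρ n).agree a).tasks) (hTq : T.seq ≤ q) :
    (∀ m ∈ T.todo, ∃ j, D.agreeDoes ρ j a (.commitSend m.seq m)) ∧
    ∃ k, T.seq + D.agWin ≤ ((D.state ρ k).agree a).winMax := by
  obtain ⟨sq, l⟩ := T
  induction l generalizing n with
  | nil => exact absurd rfl ((agree_tracks hagree hcp hR ha n).todo_ne _ hT)
  | cons x l ih =>
    have htr := (agree_tracks hagree hcp hR ha n).todo _ hT x List.mem_cons_self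
    have hout := outstanding_of_task hT rfl
    obtain ⟨j, hj, ⟨y, hy⟩, hno⟩ := hout.returns hq ha (htr.2.trans hTq)
    have hstay : ∀ k, n ≤ k → k ≤ j → (⟨sq, x :: l⟩ : CpTask C Op) ∈
        ((D.state ρ k).agree a).tasks := by
      intro k hk
      induction k, hk using Nat.le_induction with
      | base => exact fun _ => hT
      | succ k hk ihk =>
        intro hkj
        have := ihk (by omega)
        rcases agree_cases ρ k a with ⟨i, hi, hs⟩ | ⟨hi, hs⟩
        · rw [hs]
          refine mem_agreeStep_tasks this (by simp) ?_
          rintro p y rfl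
          by_contra hp
          simp only [CpTask.waitsFor, decide_eq_false_iff_not, not_not] at hp
          subst hp
          exact hno k hk (by omega) y hi
        · rwa [hs]
    -- `Outstanding` forgets the message, but the log determines it from the position.
    have hxs : ∃ j, D.agreeDoes ρ j a (.commitSend x.seq x) := by
      obtain ⟨j, -, x', hx', -⟩ := hout
      have := commitSend_eq hagree hcp hR ha hx'
      rw [htr.1.trans this.symm] at hx' ⊢
      subst this
      exact ⟨j, hx'⟩
    have hadv := advance_mem_or (ka := D.ka) (capC := D.capC) (agWin := D.agWin) (y := y)
      (hstay j hj le_rfl) (p := x.seq) (by simp [CpTask.waitsFor])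
    rw [← agree_step hy] at hadv
    rcases hadv with hadv | ⟨hnil, hwin⟩
    · obtain ⟨h1, h2⟩ := ih hadv hTq
      refine ⟨fun m hm => ?_, h2⟩
      rcases List.mem_cons.mp hm with rfl | hm
      · exact hxs
      · exact h1 m hm
    · simp only [List.tail_cons] at hnil
      subst hnil
      refine ⟨fun m hm => ?_, j + 1, hwin⟩
      obtain rfl := List.mem_singleton.mp hm
      exact hxs

/-- The effect of a stable checkpoint if the `send` calls return. -/
theorem stable_anchors (hagree : D.IsAgreement ρ)
    (hcp : (D.agreeCheckpoints ρ).IsCheckpoint D.correctAgree D.fa)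
    {R : ℕ → Request C Op} (hR : D.IsLog ρ R) {a} (ha : a ∈ D.correctAgree) {q : ℕ}
    (hq : D.SendsReturn ρ q) {n s x} (h : ρ n = .agree a (.stable s x)) (hs : s ≤ q) :
    (∀ m, ((D.state ρ n).agree a).sn < m → m ≤ s → s < m + D.capC →
      ∃ j, D.agreeDoes ρ j a (.commitSend m ⟨R m, m⟩)) ∧
    ∃ k, s + D.agWin ≤ ((D.state ρ k).agree a).winMax := by
  by_cases hlt : ((D.state ρ n).agree a).sn < s
  · have hmem : ∀ m, ((D.state ρ n).agree a).sn < m → m ≤ s → s < m + D.capC →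
        (⟨R m, m⟩ : Execute C Op) ∈ (newTask ((D.state ρ n).agree a) s x).todo := by
      intro m h1 h2 h3
      refine List.mem_filter.mpr ⟨?_, by simpa using h1⟩
      rw [agree_stable_eq hagree hcp hR ha h]
      exact agreeLog_hist_mem (by omega) h2 h3
    have := newTask_mem_or (ka := D.ka) (capC := D.capC) (agWin := D.agWin) (x := x) hlt
    rw [← agree_step h] at this
    rcases this with hT | ⟨hnil, hw⟩
    · obtain ⟨h1, h2⟩ := task_completes hagree hcp hR ha hq hT hs
      exact ⟨fun m ha hb hc => h1 _ (hmem m ha hb hc), h2⟩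
    · refine ⟨fun m ha hb hc => ?_, n + 1, hw⟩
      have := hmem m ha hb hc
      rw [hnil] at this
      cases this
  · refine ⟨fun m h1 h2 => by omega, n + 1, ?_⟩
    rw [agree_step h]
    simp only [agreeStep, if_neg hlt]
    exact le_max_right _ _

/-- Replica `a` eventually processes or skips sequence number `m`. -/
def AgreeReaches (D : Deployment C Op V St) (ρ : D.Run) (a : Fin (3 * D.fa + 1)) (m : ℕ) : Prop :=
  ∃ n, m ≤ ((D.state ρ n).agree a).sn

theorem AgreeReaches.mono {a m m'} (h : D.AgreeReaches ρ a m) (hm : m' ≤ m) :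
    D.AgreeReaches ρ a m' :=
  h.imp fun _ => hm.trans

/-- The step in which a replica reaches `m`. -/
theorem AgreeReaches.step (hagree : D.IsAgreement ρ)
    (hcp : (D.agreeCheckpoints ρ).IsCheckpoint D.correctAgree D.fa)
    {R : ℕ → Request C Op} (hR : D.IsLog ρ R) {a} (ha : a ∈ D.correctAgree) {m : ℕ} (hm : 1 ≤ m)
    (h : D.AgreeReaches ρ a m) :
    ∃ n, ((D.state ρ n).agree a).sn < m ∧
      ((D.agreeDoes ρ n a (.commitSend m ⟨R m, m⟩) ∧
        ((D.state ρ (n + 1)).agree a).deliv = some (.sending m (agreeLog D.capC R m))) ∨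
      ∃ s x, m ≤ s ∧ ρ n = .agree a (.stable s x)) := by
  classical
  -- The first crossing of `m`. A resumed callback raises `sn` by exactly one and so hits `m`
  -- itself; only a checkpoint can jump over it.
  obtain ⟨n, hn, hmin⟩ : ∃ n, m ≤ ((D.state ρ (n + 1)).agree a).sn ∧
      ((D.state ρ n).agree a).sn < m := by
    have hspec := Nat.find_spec h
    have hmin : ∀ k < Nat.find h, _ := fun k hk => Nat.find_min h hk
    cases hk : Nat.find h with
    | zero =>
      rw [hk] at hspec
      simp [state, agreeInit] at hspec
      omega
    | succ k =>
      rw [hk] at hspec hmin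
      exact ⟨k, hspec, not_le.mp (hmin k (Nat.lt_succ_self k))⟩
  refine ⟨n, hmin, ?_⟩
  rcases agree_cases ρ n a with ⟨i, hi, hs⟩ | ⟨hi, hs⟩
  · rcases agreeStep_log (ka := D.ka) (capC := D.capC) (agWin := D.agWin)
      (σ := (D.state ρ n).agree a) i with
      ⟨h1, -⟩ | ⟨s, r, rfl, hd, hw, hlt⟩ | ⟨s, x, rfl, -, h1, -⟩
    · rw [hs, h1] at hn
      omega
    · have htr := agree_tracks hagree hcp hR ha n
      obtain ⟨rfl, -, hle⟩ := htr.waiting s r hd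
      have hrs := agreeStep_resume (ka := D.ka) (capC := D.capC) (agWin := D.agWin) hd hw hlt
      obtain rfl : s = m := by
        rw [hs, hrs] at hn
        simp only at hn
        omega
      refine .inl ⟨⟨_, hi, by rw [hrs]; exact List.mem_singleton_self _⟩, ?_⟩
      rw [hs, hrs, ← agreeLog_of_resume htr hd hlt]
    · rw [hs, h1] at hn
      exact .inr ⟨s, x, hn, hi⟩
  · rw [hs] at hn
    omega

/-- A replica that reaches `m` has its message at `m` accepted by the commit channel, unless it
skips `m` by a checkpoint whose history does not contain `m` any more. -/
theorem AgreeReaches.sent (hagree : D.IsAgreement ρ)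
    (hcp : (D.agreeCheckpoints ρ).IsCheckpoint D.correctAgree D.fa)
    {R : ℕ → Request C Op} (hR : D.IsLog ρ R) {a} (ha : a ∈ D.correctAgree) {m q : ℕ} (hm : 1 ≤ m)
    (h : D.AgreeReaches ρ a m) (hq : D.SendsReturn ρ q) (hmq : m ≤ q)
    (hst : ∀ n s x, ρ n = .agree a (.stable s x) → s ≤ q ∧ s < m + D.capC) :
    ∃ n, ρ n = .agree a (.sent m ⟨R m, m⟩) := by
  suffices h : ∃ n, D.agreeDoes ρ n a (.commitSend m ⟨R m, m⟩) by
    obtain ⟨n, hn⟩ := h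
    exact (hq a ha n m _ hmq hn).imp fun _ h => h.2
  obtain ⟨n, hlt, ⟨h, -⟩ | ⟨s, x, hms, hs⟩⟩ := h.step hagree hcp hR ha hm
  · exact ⟨n, h⟩
  · exact (stable_anchors hagree hcp hR ha hq hs (hst n s x hs).1).1 m hlt hms (hst n s x hs).2

/-- A `deliver` callback sending `m` completes if the `send` call returns. -/
theorem sending_completes {a} (ha : a ∈ D.correctAgree) (hagree : D.IsAgreement ρ) {q : ℕ}
    (hq : D.SendsReturn ρ q) {n m x}
    (h : ((D.state ρ n).agree a).deliv = some (.sending m x)) (hm : m ≤ q) :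
    ∃ j ≥ n, ((D.state ρ (j + 1)).agree a).deliv = none ∧
      (m % D.ka = 0 → D.agreeDoes ρ j a (.genCp m x)) := by
  obtain ⟨j, hj, ⟨y, hy⟩, hno⟩ := (outstanding_of_sending h).returns hq ha hm
  have hstay : ∀ k, n ≤ k → k ≤ j → ((D.state ρ k).agree a).deliv = some (.sending m x) := by
    intro k hk
    induction k, hk using Nat.le_induction with
    | base => exact fun _ => h
    | succ k hk ihk =>
      intro hkj
      have hd' := ihk (by omega)
      rcases agree_cases ρ k a with ⟨i, hi, hs⟩ | ⟨hi, hs⟩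
      · rcases agreeStep_deliv (ka := D.ka) (capC := D.capC) (agWin := D.agWin)
          (σ := (D.state ρ k).agree a) i with
          ⟨h1, -⟩ | ⟨s', r', rfl, h1⟩ | ⟨s', r', -, hd, hle, h1⟩ | ⟨s', r', rfl, hd, hw, hlt⟩ |
          ⟨s', y, x, rfl, hd, h1, -⟩
        · rw [hs, h1, hd']
        · have := hagree.blocking a ha k s' r' hi
          rw [hd'] at this
          cases this
        · rw [hd'] at hd
          cases hd
        · rw [hd'] at hd
          cases hd
        · rw [hd'] at hd
          cases hd
          exact absurd hi (hno k hk (by omega) y)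
      · rw [hs, hd']
  have hdj := hstay j hj le_rfl
  refine ⟨j, hj, ?_⟩
  rcases agreeStep_deliv (ka := D.ka) (capC := D.capC) (agWin := D.agWin)
    (σ := (D.state ρ j).agree a) (.sent m y) with
    ⟨-, h2, -⟩ | ⟨s', r', h1, -⟩ | ⟨s', r', h1, -⟩ | ⟨s', r', h1, -⟩ | ⟨s', y', x', h1, hd, h2, h3⟩
  · exact absurd hdj (h2 m y x rfl)
  · cases h1
  · cases h1
  · cases h1
  · cases h1
    rw [hdj] at hd
    cases hd
    exact ⟨by rw [agree_step hy, h2], fun h0 => ⟨_, hy, h3 h0⟩⟩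

/-- A replica that reaches the multiple `m` of the checkpoint interval without the help of a stable
checkpoint generates the checkpoint for `m`. -/
theorem AgreeReaches.genCp (hagree : D.IsAgreement ρ)
    (hcp : (D.agreeCheckpoints ρ).IsCheckpoint D.correctAgree D.fa)
    {R : ℕ → Request C Op} (hR : D.IsLog ρ R) {a} (ha : a ∈ D.correctAgree) {m : ℕ} (hm : 1 ≤ m)
    (h : D.AgreeReaches ρ a m) (hq : D.SendsReturn ρ m) (hka : m % D.ka = 0)
    (hst : ∀ n s x, ρ n = .agree a (.stable s x) → s < m) :
    ∃ n, D.agreeDoes ρ n a (.genCp m (agreeLog D.capC R m)) := by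
  obtain ⟨n, -, ⟨-, hd⟩ | ⟨s, x, hms, hs⟩⟩ := h.step hagree hcp hR ha hm
  · obtain ⟨j, -, -, h⟩ := sending_completes ha hagree hq hd le_rfl
    exact ⟨j, h hka⟩
  · have := hst n s x hs
    omega

/-- What it means for a replica to be blocked in a `deliver` callback forever. -/
theorem Stuck.blocked (hagree : D.IsAgreement ρ) (hfair : D.FairScheduling ρ)
    (hcp : (D.agreeCheckpoints ρ).IsCheckpoint D.correctAgree D.fa)
    {R : ℕ → Request C Op} (hR : D.IsLog ρ R) {a} (ha : a ∈ D.correctAgree)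
    (h : D.Stuck ρ a) :
    ∃ s, ∀ q, D.SendsReturn ρ q → ∀ s₀ ≤ q,
      (s₀ = 0 ∨ ∃ n x, ρ n = .agree a (.stable s₀ x)) →
      (q < s ∧ D.AgreeReaches ρ a s) ∨ (s₀ + D.agWin < s ∧ D.AgreeReaches ρ a (s - 1)) := by
  obtain ⟨N, hN⟩ := h
  have hnone : ∀ k ≥ N, ((D.state ρ k).agree a).deliv ≠ none := by
    intro k hk h0
    have := hN k hk
    simp [h0] at this
  -- Either the callback is eventually blocked in a `send`, whose position must then exceed every
  -- `q` up to which sends return; or it sleeps forever at a single position outside the window.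
  by_cases hsend : ∃ n ≥ N, ∃ s x, ((D.state ρ n).agree a).deliv = some (.sending s x)
  · obtain ⟨n, hn, s, x, hd⟩ := hsend
    refine ⟨s, fun q hq s₀ _ _ => .inl ⟨?_, n, ((agree_tracks hagree hcp hR ha n).sending s x hd).2⟩⟩
    by_contra hle
    obtain ⟨j, hj, hj', -⟩ := sending_completes ha hagree hq hd (not_lt.mp hle)
    exact hnone (j + 1) (by omega) hj'
  · push Not at hsend
    obtain ⟨s, r, hsr⟩ : ∃ s r, ((D.state ρ N).agree a).deliv = some (.waiting s r) := by
      cases hd : ((D.state ρ N).agree a).deliv with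
      | none => exact absurd hd (hnone N le_rfl)
      | some ph =>
        cases ph with
        | waiting s r => exact ⟨s, r, rfl⟩
        | sending s x => exact absurd hd (hsend N le_rfl s x)
    have hstay : ∀ k ≥ N, ((D.state ρ k).agree a).deliv = some (.waiting s r) ∧
        (ρ k = .agree a .resume → ((D.state ρ k).agree a).winMax < s) := by
      have hres : ∀ k ≥ N, ((D.state ρ k).agree a).deliv = some (.waiting s r) →
          ((D.state ρ (k + 1)).agree a).deliv = some (.waiting s r) ∧
          (ρ k = .agree a .resume → ((D.state ρ k).agree a).winMax < s) := by
        intro k hk hd'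
        rcases agree_cases ρ k a with ⟨i, hi, hs⟩ | ⟨hi, hs⟩
        · rcases agreeStep_deliv (ka := D.ka) (capC := D.capC) (agWin := D.agWin)
            (σ := (D.state ρ k).agree a) i with
            ⟨h1, -, h3⟩ | ⟨s', r', rfl, h1⟩ | ⟨s', r', -, hd, hle, h1⟩ |
            ⟨s', r', rfl, hd, hw, hlt⟩ | ⟨s', y, x, rfl, hd, h1, -⟩
          · refine ⟨by rw [hs, h1, hd'], fun hr => ?_⟩
            rw [hi] at hr
            cases hr
            exact h3 s r rfl hd'
          · have := hagree.blocking a ha k s' r' hi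
            rw [hd'] at this
            cases this
          · exact absurd (hs ▸ h1) (hnone (k + 1) (by omega))
          · have := hsend (k + 1) (by omega)
            rw [hs, agreeStep_resume hd hw hlt] at this
            exact absurd rfl (this _ _)
          · exact absurd (hs ▸ h1) (hnone (k + 1) (by omega))
        · exact ⟨by rw [hs, hd'], fun hr => absurd hr (hi _)⟩
      have hall : ∀ k ≥ N, ((D.state ρ k).agree a).deliv = some (.waiting s r) := by
        intro k hk
        induction k, hk using Nat.le_induction with
        | base => exact hsr
        | succ k hk ih => exact (hres k hk ih).1
      exact fun k hk => ⟨hall k hk, (hres k hk (hall k hk)).2⟩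
    refine ⟨s, fun q hq s₀ hs₀ hstab => .inr ⟨?_, N, ?_⟩⟩
    -- For `s₀ = 0` this is the initial window. If `s` were inside, fairness would produce a
    -- `resume` that ends the sleep.
    · obtain ⟨k, hk⟩ : ∃ k, s₀ + D.agWin ≤ ((D.state ρ k).agree a).winMax := by
        rcases hstab with rfl | ⟨n, x, hx⟩
        · exact ⟨0, by simp [state, agreeInit]⟩
        · exact (stable_anchors hagree hcp hR ha hq hx hs₀).2
      by_contra hle
      have hw : s ≤ ((D.state ρ (max k N)).agree a).winMax :=
        (not_lt.mp hle).trans (hk.trans (agree_winMax_mono ρ a (le_max_left k N)))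
      obtain ⟨j, hj, hr⟩ := hfair.resume a ha (max k N) s r (hstay _ (le_max_right _ _)).1 hw
      have h1 := (hstay j ((le_max_right k N).trans hj)).2 hr
      have h2 : ((D.state ρ (max k N)).agree a).winMax ≤ ((D.state ρ j).agree a).winMax :=
        agree_winMax_mono ρ a hj
      omega
    · have := ((agree_tracks hagree hcp hR ha N).waiting s r hsr).2.2
      omega

/-- A replica that covers `s` and is not blocked forever reaches `s`. -/
theorem Covers.reaches (hagree : D.IsAgreement ρ) {a} (ha : a ∈ D.correctAgree) {s r}
    (h : D.Covers ρ a s r) (hns : ¬ D.Stuck ρ a) : D.AgreeReaches ρ a s := by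
  rcases h with ⟨n, hn⟩ | ⟨-, n, g, hg, hgc⟩
  · simp only [Stuck, not_exists, not_forall] at hns
    obtain ⟨k, hk, hd⟩ := hns (n + 1)
    rcases delivered_le_sn hagree ha hn (n := k) (by omega) with h | h
    · exact ⟨k, h⟩
    · simp [h] at hd
  · have := gc_le_sn (n := n + 1) hgc (Nat.lt_succ_self n)
    exact ⟨n + 1, by omega⟩

theorem Covers.eq_log {R : ℕ → Request C Op} (hR : D.IsLog ρ R) {a} (ha : a ∈ D.correctAgree)
    {s r} (h : D.Covers ρ a s r) : R s = r := by
  rcases h with ⟨n, hn⟩ | ⟨⟨a', ha', n, hn⟩, -⟩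
  · exact (hR a ha n s r hn).symm
  · exact (hR a' ha' n s r hn).symm

end Deployment

/-! ## One step of an execution replica -/

/-- The replies and the application state after the first `s` requests of the log `R`. -/
def execLog [DecidableEq C] (app : App St Op V) (R : ℕ → Request C Op) : ℕ → ExecCp C V St
  | 0 => (fun _ => none, app.init)
  | s + 1 =>
    let x := execLog app R s
    let r := R (s + 1)
    let res := app.exec x.2 r.op
    (if isNew (x.1 r.client) r.counter = true then
      Function.update x.1 r.client (some (r.counter, res.2)) else x.1,
      if isNew (x.1 r.client) r.counter = true then res.1 else x.2)

section ExecStep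

variable [DecidableEq C] {ke : ℕ} {app : App St Op V} {σ : ExecState C V St}

theorem execRequest_log {R : ℕ → Request C Op} (h : (σ.last, σ.app) = execLog app R σ.sn) :
    ((execRequest ke app σ (R (σ.sn + 1))).1.last, (execRequest ke app σ (R (σ.sn + 1))).1.app) =
      execLog app R (σ.sn + 1) := by
  simp only [execLog, ← h, execRequest]

theorem sn_le_execStep (i : ExecIn C Op V St) : σ.sn ≤ (execStep ke app σ i).1.sn := by
  cases i with
  | write r mac =>
    simp only [execStep]
    split_ifs
    · exact le_rfl
    · split <;> exact le_rfl
    · exact le_rfl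
    · exact le_rfl
  | received x =>
    cases x with
    | msg x => exact Nat.le_succ _
    | tooOld p => exact le_rfl
  | sent c p r => exact le_rfl
  | stable s x =>
    simp only [execStep]
    split_ifs with h
    · exact h.le
    · exact le_rfl

theorem execStep_write_fst (r : Request C Op) (mac : Bool) :
    (execStep ke app σ (.write r mac)).1.sn = σ.sn ∧
    (execStep ke app σ (.write r mac)).1.last = σ.last ∧
    (execStep ke app σ (.write r mac)).1.app = σ.app ∧
    (execStep ke app σ (.write r mac)).1.pos = σ.pos := by
  simp only [execStep]
  split_ifs
  · exact ⟨rfl, rfl, rfl, rfl⟩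
  · split <;> exact ⟨rfl, rfl, rfl, rfl⟩
  · exact ⟨rfl, rfl, rfl, rfl⟩
  · exact ⟨rfl, rfl, rfl, rfl⟩

/-- Which inputs cause which calls. -/
theorem mem_execStep {i : ExecIn C Op V St} {o : ExecOut C Op V St}
    (ho : o ∈ (execStep ke app σ i).2) :
    (∃ r t v, i = .write r true ∧ σ.last r.client = some (t, v) ∧ o = .reply r.client t v) ∨
    (∃ r, i = .write r true ∧ (o = .reqMove r.client r.counter ∨
      o = .reqSend r.client r.counter r)) ∨
    (∃ m v, i = .received (.msg m) ∧ o = .reply m.req.client m.req.counter v ∧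
      (execRequest ke app σ m.req).1.last m.req.client = some (m.req.counter, v)) ∨
    (∃ m, i = .received (.msg m) ∧ (σ.sn + 1) % ke = 0 ∧ o = .genCp (σ.sn + 1)
      ((execRequest ke app σ m.req).1.last, (execRequest ke app σ m.req).1.app)) ∨
    (∃ p, o = .fetchCp p) ∨
    ∃ s x, i = .stable s x ∧ o = .commitMove (s + 1) := by
  cases i with
  | write r mac =>
    simp only [execStep] at ho
    split_ifs at ho with h1 h2 h3
    · simp at ho
    · have hmac : mac = true := by simpa using h1
      subst hmac
      split at ho
      · next t v hl =>
        split_ifs at ho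
        · exact .inl ⟨r, t, v, rfl, hl, by simpa using ho⟩
        · simp at ho
      · simp at ho
    · simp at ho
    · have hmac : mac = true := by simpa using h1
      subst hmac
      exact .inr (.inl ⟨r, rfl, by simpa using ho⟩)
  | received x =>
    cases x with
    | msg m =>
      simp only [execStep, execRequest] at ho
      rcases List.mem_append.mp ho with ho | ho
      · split_ifs at ho with h
        · refine .inr (.inr (.inl ⟨m, _, rfl, List.mem_singleton.mp ho, ?_⟩))
          simp [execRequest, h]
        · simp at ho
      · split at ho
        · next h =>
          exact .inr (.inr (.inr (.inl ⟨m, rfl, h, List.mem_singleton.mp ho⟩)))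
        · simp at ho
    | tooOld p => exact .inr (.inr (.inr (.inr (.inl ⟨p, by simpa [execStep] using ho⟩))))
  | sent c p r => simp [execStep] at ho
  | stable s x =>
    refine .inr (.inr (.inr (.inr (.inr ⟨s, x, rfl, ?_⟩))))
    simp only [execStep] at ho
    split_ifs at ho <;> simpa using ho

theorem genCp_mem_execStep {i : ExecIn C Op V St} {s : ℕ} {x : ExecCp C V St}
    (h : .genCp s x ∈ (execStep ke app σ i).2) :
    ∃ m, i = .received (.msg m) ∧ s = σ.sn + 1 ∧ s % ke = 0 ∧
      x = ((execRequest ke app σ m.req).1.last, (execRequest ke app σ m.req).1.app) := by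
  rcases mem_execStep h with ⟨r, t, v, -, -, h⟩ | ⟨r, -, h | h⟩ | ⟨m, v, -, h, -⟩ |
    ⟨m, hi, hk, h⟩ | ⟨p, h⟩ | ⟨s', x', -, h⟩
  all_goals cases h
  exact ⟨m, hi, rfl, hk, rfl⟩

theorem commitMove_mem_execStep {i : ExecIn C Op V St} {p : ℕ}
    (h : .commitMove p ∈ (execStep ke app σ i).2) : ∃ s x, i = .stable s x ∧ p = s + 1 := by
  rcases mem_execStep h with ⟨r, t, v, -, -, h⟩ | ⟨r, -, h | h⟩ | ⟨m, v, -, h, -⟩ |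
    ⟨m, hi, hk, h⟩ | ⟨p, h⟩ | ⟨s', x', hi, h⟩
  all_goals cases h
  exact ⟨s', x', hi, rfl⟩

theorem reqMove_mem_execStep {i : ExecIn C Op V St} {c : C} {p : ℕ}
    (h : .reqMove c p ∈ (execStep ke app σ i).2) :
    ∃ r, i = .write r true ∧ c = r.client ∧ p = r.counter := by
  rcases mem_execStep h with ⟨r, t, v, -, -, h⟩ | ⟨r, hi, h | h⟩ | ⟨m, v, -, h, -⟩ |
    ⟨m, -, hk, h⟩ | ⟨p, h⟩ | ⟨s', x', -, h⟩
  all_goals cases h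
  exact ⟨r, hi, rfl, rfl⟩

theorem reqSend_mem_execStep {i : ExecIn C Op V St} {c : C} {p : ℕ} {r : Request C Op}
    (h : .reqSend c p r ∈ (execStep ke app σ i).2) :
    i = .write r true ∧ c = r.client ∧ p = r.counter := by
  rcases mem_execStep h with ⟨r, t, v, -, -, h⟩ | ⟨r, hi, h | h⟩ | ⟨m, v, -, h, -⟩ |
    ⟨m, -, hk, h⟩ | ⟨p, h⟩ | ⟨s', x', -, h⟩
  all_goals cases h
  exact ⟨hi, rfl, rfl⟩

theorem reply_mem_execStep {i : ExecIn C Op V St} {c : C} {t : ℕ} {v : V}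
    (h : .reply c t v ∈ (execStep ke app σ i).2) :
    σ.last c = some (t, v) ∨
    ∃ m, i = .received (.msg m) ∧ (execRequest ke app σ m.req).1.last c = some (t, v) := by
  rcases mem_execStep h with ⟨r, t, v, -, hl, h⟩ | ⟨r, -, h | h⟩ | ⟨m, v, hi, h, hl⟩ |
    ⟨m, -, hk, h⟩ | ⟨p, h⟩ | ⟨s', x', -, h⟩
  all_goals cases h
  · exact .inl hl
  · exact .inr ⟨m, hi, hl⟩

end ExecStep

/-! ## The reply recorded in the log -/

section ExecLog

variable [DecidableEq C] {app : App St Op V} {R : ℕ → Request C Op} {c : C} {t : ℕ}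

theorem execLog_counter_le (h : ∀ i, (R i).client = c → (R i).counter ≤ t) {s t' : ℕ} {v : V}
    (hs : (execLog app R s).1 c = some (t', v)) : t' ≤ t := by
  induction s generalizing t' v with
  | zero => simp [execLog] at hs
  | succ s ih =>
    simp only [execLog] at hs
    split_ifs at hs with hn
    · rw [Function.update_apply] at hs
      split_ifs at hs with hc
      · cases hs
        exact h _ hc.symm
      · exact ih hs
    · exact ih hs

/-- No log entry of `c` has a counter above `t`, so the test `isNew` fails for all later entries of
`c` and the stored reply is frozen. -/
theorem execLog_stays (h : ∀ i, (R i).client = c → (R i).counter ≤ t) {s s' : ℕ} (hss : s ≤ s')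
    {v : V} (hs : (execLog app R s).1 c = some (t, v)) :
    (execLog app R s').1 c = some (t, v) := by
  induction s', hss using Nat.le_induction with
  | base => exact hs
  | succ s' hle ih =>
    simp only [execLog]
    split_ifs with hn
    · rw [Function.update_apply]
      split_ifs with hc
      · rw [← hc, ih] at hn
        have := h _ hc.symm
        simp only [isNew, decide_eq_true_eq] at hn
        omega
      · exact ih
    · exact ih

theorem execLog_unique (h : ∀ i, (R i).client = c → (R i).counter ≤ t) {s s' : ℕ} {v v' : V}
    (hs : (execLog app R s).1 c = some (t, v)) (hs' : (execLog app R s').1 c = some (t, v')) :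
    v = v' := by
  rcases le_total s s' with hle | hle
  · have := execLog_stays h hle hs
    rw [hs'] at this
    cases this
    rfl
  · have := execLog_stays h hle hs'
    rw [hs] at this
    cases this
    rfl

/-- If the entry is not executed, a reply with a counter at least `t` is already stored, and
maximality of `t` forces equality. -/
theorem exists_execLog (h : ∀ i, (R i).client = c → (R i).counter ≤ t) {s : ℕ} (hs : 1 ≤ s)
    (hc : (R s).client = c) (ht : (R s).counter = t) :
    ∃ v, (execLog app R s).1 c = some (t, v) := by
  obtain ⟨s, rfl⟩ := Nat.exists_eq_add_of_le' hs
  simp only [execLog, hc, ht]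
  split_ifs with hn
  · exact ⟨_, Function.update_self _ _ _⟩
  · cases hl : (execLog app R s).1 c with
    | none =>
      rw [hl] at hn
      exact absurd rfl hn
    | some x =>
      obtain ⟨t', v⟩ := x
      rw [hl] at hn
      simp only [isNew, decide_eq_true_eq, not_lt] at hn
      exact ⟨v, by rw [le_antisymm (execLog_counter_le h hl) hn]⟩

end ExecLog

/-! ## Execution replicas follow the agreed log -/

namespace Deployment

variable [DecidableEq C] [DecidableEq V] {D : Deployment C Op V St} {ρ : D.Run}

theorem exec_sn_mono (ρ : D.Run) (e) : Monotone fun n => ((D.state ρ n).exec e).sn := by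
  refine monotone_nat_of_le_succ fun n => ?_
  rcases exec_cases ρ n e with ⟨i, -, hs⟩ | ⟨-, hs⟩
  · rw [hs]
    exact sn_le_execStep i
  · rw [hs]

theorem le_exec_sn_of_stable {n e s x} (h : ρ n = .exec e (.stable s x)) :
    s ≤ ((D.state ρ (n + 1)).exec e).sn := by
  rw [exec_step h]
  simp only [execStep]
  split_ifs with hs
  · exact le_rfl
  · exact not_lt.mp hs

theorem commitMove_of_stable {n e s x} (h : ρ n = .exec e (.stable s x)) :
    D.execDoes ρ n e (.commitMove (s + 1)) := by
  refine ⟨_, h, ?_⟩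
  simp only [execStep]
  split_ifs <;> exact List.mem_singleton_self _

/-- A message returned by the outstanding `receive` call is the next one of the log, provided that
the replica has followed the log so far. -/
theorem received_eq (hagree : D.IsAgreement ρ)
    (hcpA : (D.agreeCheckpoints ρ).IsCheckpoint D.correctAgree D.fa)
    {R : ℕ → Request C Op} (hR : D.IsLog ρ R) {win : ℕ → Fin (2 * D.fe + 1) → Unit → ℕ}
    (hch : (D.commitChannel ρ).Valid D.correctAgree D.correctExec D.fa D.fe D.capC win)
    {e} (he : e ∈ D.correctExec) {n m} (h : ρ n = .exec e (.received (.msg m)))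
    (hpos : ((D.state ρ n).exec e).pos = ((D.state ρ n).exec e).sn + 1 ∨
      (((D.state ρ n).exec e).pos < ((D.state ρ n).exec e).sn + 1 ∧
        ((D.state ρ n).exec e).sn + 1 ≤ win n e ())) :
    m.req = R (((D.state ρ n).exec e).sn + 1) := by
  obtain ⟨⟨a, ha, j, -, hj⟩, hw, -⟩ := hch.receive_msg e he n () _ m ⟨h, rfl⟩
  have hm := commitSend_eq hagree hcpA hR ha hj
  -- A lagging `receive` is below the window, whereas messages are returned only for positions
  -- inside it.
  have : ((D.state ρ n).exec e).pos = ((D.state ρ n).exec e).sn + 1 := by omega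
  rw [hm, this]

/-- Adopting a checkpoint raises `sn` while the old `receive` call stays outstanding, so `pos` may
lag. The same callback moves the commit window past `sn`, hence the stale call can only return
`TooOld`. As for agreement replicas, the induction over time treats all replicas together. -/
theorem exec_tracks (hagree : D.IsAgreement ρ)
    (hcpA : (D.agreeCheckpoints ρ).IsCheckpoint D.correctAgree D.fa)
    (hcpE : (D.execCheckpoints ρ).IsCheckpoint D.correctExec D.fe)
    {R : ℕ → Request C Op} (hR : D.IsLog ρ R) {win : ℕ → Fin (2 * D.fe + 1) → Unit → ℕ}
    (hch : (D.commitChannel ρ).Valid D.correctAgree D.correctExec D.fa D.fe D.capC win)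
    {e} (he : e ∈ D.correctExec) (n : ℕ) :
    (((D.state ρ n).exec e).last, ((D.state ρ n).exec e).app) =
      execLog D.app R ((D.state ρ n).exec e).sn ∧
    (((D.state ρ n).exec e).pos = ((D.state ρ n).exec e).sn + 1 ∨
      (((D.state ρ n).exec e).pos < ((D.state ρ n).exec e).sn + 1 ∧
        ((D.state ρ n).exec e).sn + 1 ≤ win n e ())) := by
  induction n using Nat.strong_induction_on generalizing e with
  | _ n ih =>
    cases n with
    | zero => exact ⟨rfl, .inl rfl⟩
    | succ n =>
      obtain ⟨h1, h2⟩ := ih n (Nat.lt_succ_self n) he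
      have hwin := hch.win_mono e he () n
      rcases exec_cases ρ n e with ⟨i, hi, hs⟩ | ⟨-, hs⟩
      · rw [hs]
        cases i with
        | write r mac =>
          obtain ⟨e1, e2, e3, e4⟩ := execStep_write_fst (ke := D.ke) (app := D.app)
            (σ := (D.state ρ n).exec e) r mac
          rw [e1, e2, e3, e4]
          exact ⟨h1, by omega⟩
        | received x =>
          cases x with
          | msg m =>
            simp only [execStep, received_eq hagree hcpA hR hch he hi h2]
            exact ⟨execRequest_log h1, .inl rfl⟩
          | tooOld p => exact ⟨h1, .inl rfl⟩
        | sent c p r => exact ⟨h1, by simp only [execStep]; omega⟩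
        | stable s x =>
          have hmove := hch.win_move e he n () _ (commitMove_of_stable hi)
          simp only [execStep]
          split_ifs with hlt
          · obtain ⟨e', he', j, hj, i', hi', hgen⟩ := hcpE.safety e he n s x hi
            obtain ⟨m, rfl, rfl, -, rfl⟩ := genCp_mem_execStep hgen
            obtain ⟨h1', h2'⟩ := ih j (by omega) he'
            rw [received_eq hagree hcpA hR hch he' hi' h2']
            refine ⟨execRequest_log (ke := D.ke) h1', .inr ⟨?_, hmove⟩⟩
            simp only
            omega
          · exact ⟨h1, by simp only; omega⟩
      · rw [hs]
        exact ⟨h1, by omega⟩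

theorem exec_genCp_eq (hagree : D.IsAgreement ρ)
    (hcpA : (D.agreeCheckpoints ρ).IsCheckpoint D.correctAgree D.fa)
    (hcpE : (D.execCheckpoints ρ).IsCheckpoint D.correctExec D.fe)
    {R : ℕ → Request C Op} (hR : D.IsLog ρ R) {win : ℕ → Fin (2 * D.fe + 1) → Unit → ℕ}
    (hch : (D.commitChannel ρ).Valid D.correctAgree D.correctExec D.fa D.fe D.capC win)
    {e} (he : e ∈ D.correctExec) {n m} (h : ρ n = .exec e (.received (.msg m)))
    (hk : (((D.state ρ n).exec e).sn + 1) % D.ke = 0) :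
    D.execDoes ρ n e (.genCp (((D.state ρ n).exec e).sn + 1)
      (execLog D.app R (((D.state ρ n).exec e).sn + 1))) := by
  obtain ⟨h1, h2⟩ := exec_tracks hagree hcpA hcpE hR hch he n
  refine ⟨_, h, ?_⟩
  rw [← execRequest_log (ke := D.ke) h1]
  simp only [execStep, received_eq hagree hcpA hR hch he h h2]
  simp [execRequest, hk]

/-- Every reply sent by a correct replica is recorded in the log. -/
theorem exec_reply_log (hagree : D.IsAgreement ρ)
    (hcpA : (D.agreeCheckpoints ρ).IsCheckpoint D.correctAgree D.fa)
    (hcpE : (D.execCheckpoints ρ).IsCheckpoint D.correctExec D.fe)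
    {R : ℕ → Request C Op} (hR : D.IsLog ρ R) {win : ℕ → Fin (2 * D.fe + 1) → Unit → ℕ}
    (hch : (D.commitChannel ρ).Valid D.correctAgree D.correctExec D.fa D.fe D.capC win)
    {e} (he : e ∈ D.correctExec) {n c t v} (h : D.execDoes ρ n e (.reply c t v)) :
    ∃ s, (execLog D.app R s).1 c = some (t, v) := by
  obtain ⟨h1, h2⟩ := exec_tracks hagree hcpA hcpE hR hch he n
  obtain ⟨i, hi, h⟩ := h
  rcases reply_mem_execStep h with h | ⟨m, rfl, hm⟩
  · exact ⟨((D.state ρ n).exec e).sn, by rw [← h1]; exact h⟩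
  · rw [received_eq hagree hcpA hR hch he hi h2] at hm
    exact ⟨((D.state ρ n).exec e).sn + 1, by rw [← execRequest_log (ke := D.ke) h1]; exact hm⟩

/-! ## Windows of the commit channel -/

/-- The windows of the commit channel do not overtake the execution checkpoints. -/
theorem exists_stable_of_win (hagree : D.IsAgreement ρ)
    (hcpA : (D.agreeCheckpoints ρ).IsCheckpoint D.correctAgree D.fa)
    {R : ℕ → Request C Op} (hR : D.IsLog ρ R) {win : ℕ → Fin (2 * D.fe + 1) → Unit → ℕ}
    (hch : (D.commitChannel ρ).Valid D.correctAgree D.correctExec D.fa D.fe D.capC win)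
    {q : ℕ} (hq : 1 < q) {e} (he : e ∈ D.correctExec) {n : ℕ} (h : q ≤ win n e ()) :
    ∃ e' ∈ D.correctExec, ∃ j s x, q ≤ s + 1 ∧ ρ j = .exec e' (.stable s x) := by
  induction n using Nat.strong_induction_on generalizing e with
  | _ n ih =>
    rcases hch.win_origin e he n () (by omega) with
      ⟨a, ha, j, hj, p, hp, i, hi, hmove⟩ | ⟨e', he', j, hj, p, hp, i, hi, hmove⟩
    · obtain ⟨s, x, rfl, rfl⟩ := commitMove_mem_agreeStep hmove
      -- The history has `min s capC` entries, so a move beyond `1` forces `s > capC` and has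
      -- argument `s + 1 - capC`. The checkpoint needed a returned `send` at `s`, hence an even
      -- earlier window with lower limit at least `s + 1 - capC`, to which the induction applies.
      rw [agree_stable_eq hagree hcpA hR ha hi, agreeLog_hist_length] at hp
      obtain ⟨a', ha', j', hj', i', hi', hgen⟩ := hcpA.safety a ha j s x hi
      obtain ⟨y, rfl, -, -⟩ := genCp_mem_agreeStep hgen
      obtain ⟨-, e', he', hw⟩ := hch.send_blocks a' ha' j' () s y hi'
      exact ih j' (by omega) he' (by omega)
    · obtain ⟨s, x, rfl, rfl⟩ := commitMove_mem_execStep hmove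
      exact ⟨e', he', j, s, x, by omega, hi⟩

/-- Agreement checkpoints do not overtake the execution checkpoints by more than the capacity of the
commit channel. -/
theorem exists_exec_stable_of_agree_stable (hagree : D.IsAgreement ρ)
    (hcpA : (D.agreeCheckpoints ρ).IsCheckpoint D.correctAgree D.fa)
    {R : ℕ → Request C Op} (hR : D.IsLog ρ R) {win : ℕ → Fin (2 * D.fe + 1) → Unit → ℕ}
    (hch : (D.commitChannel ρ).Valid D.correctAgree D.correctExec D.fa D.fe D.capC win)
    {a} (ha : a ∈ D.correctAgree) {n s x} (h : ρ n = .agree a (.stable s x))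
    (hs : D.capC < s) :
    ∃ e' ∈ D.correctExec, ∃ j s' x', s ≤ s' + D.capC ∧ ρ j = .exec e' (.stable s' x') := by
  obtain ⟨a', ha', j', hj', i', hi', hgen⟩ := hcpA.safety a ha n s x h
  obtain ⟨y, rfl, -, -⟩ := genCp_mem_agreeStep hgen
  obtain ⟨-, e', he', hw⟩ := hch.send_blocks a' ha' j' () s y hi'
  obtain ⟨e'', he'', j, s', x', hle, hst⟩ := exists_stable_of_win hagree hcpA hR hch
    (q := s + 1 - D.capC) (by omega) he' (n := j') (by omega)
  exact ⟨e'', he'', j, s', x', by omega, hst⟩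

/-- If all correct execution replicas get windows starting at `q`, then `send` calls below
`q + capC` return. -/
theorem sendsReturn_of_win {win : ℕ → Fin (2 * D.fe + 1) → Unit → ℕ}
    (hch : (D.commitChannel ρ).Valid D.correctAgree D.correctExec D.fa D.fe D.capC win) {q : ℕ}
    (h : ∀ e ∈ D.correctExec, ∃ n, q + 1 ≤ win n e ()) : D.SendsReturn ρ (q + D.capC) :=
  fun a ha n p x hp hs => hch.liveness2 () (q + 1) D.correctExec subset_rfl
    D.fe_lt_card_correctExec h a ha n p x hs (by omega)

/-! ## Progress of the execution replicas -/

/-- Replica `e` eventually executes or skips sequence number `m`. -/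
def ExecReaches (D : Deployment C Op V St) (ρ : D.Run) (e : Fin (2 * D.fe + 1)) (m : ℕ) : Prop :=
  ∃ n, m ≤ ((D.state ρ n).exec e).sn

/-- If the windows of the commit channel stay at `s₀ + 1` and `fa + 1` replicas have sent the
messages for `s₀ + 1, …, m`, then an execution replica that reaches `s₀` also reaches `m`. -/
theorem ExecReaches.of_sent (hagree : D.IsAgreement ρ)
    (hcpA : (D.agreeCheckpoints ρ).IsCheckpoint D.correctAgree D.fa)
    (hcpE : (D.execCheckpoints ρ).IsCheckpoint D.correctExec D.fe)
    {R : ℕ → Request C Op} (hR : D.IsLog ρ R) {win : ℕ → Fin (2 * D.fe + 1) → Unit → ℕ}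
    (hch : (D.commitChannel ρ).Valid D.correctAgree D.correctExec D.fa D.fe D.capC win)
    {e} (he : e ∈ D.correctExec) {s₀ m : ℕ} (h0 : D.ExecReaches ρ e s₀)
    (hwin : ∀ n, win n e () ≤ s₀ + 1) {F} (hF : F ⊆ D.correctAgree) (hcard : D.fa + 1 ≤ F.card)
    (hsent : ∀ a ∈ F, ∀ p, s₀ < p → p ≤ m → ∃ n, ρ n = .agree a (.sent p ⟨R p, p⟩))
    (hm : s₀ ≤ m) : D.ExecReaches ρ e m := by
  induction m, hm using Nat.le_induction with
  | base => exact h0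
  | succ m hm ih =>
    obtain ⟨n, hn⟩ := ih fun a ha p h1 h2 => hsent a ha p h1 (by omega)
    by_contra hno
    simp only [ExecReaches, not_exists, not_le] at hno
    -- If `m + 1` is never reached, `sn` freezes at `m`, and no message can be received any more,
    -- since each one raises `sn`.
    have hsn : ∀ k ≥ n, ((D.state ρ k).exec e).sn = m := by
      intro k hk
      have h1 := hno k
      have h2 : ((D.state ρ n).exec e).sn ≤ ((D.state ρ k).exec e).sn := exec_sn_mono ρ e hk
      omega
    have hmsg : ∀ k ≥ n, ∀ x, ρ k ≠ .exec e (.received (.msg x)) := by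
      intro k hk x hx
      have h1 := hsn k hk
      have h2 := hsn (k + 1) (by omega)
      rw [exec_step hx] at h2
      simp only [execStep, execRequest] at h2
      omega
    -- A stale call is below the window, so it returns; the answer can only be `TooOld`, which
    -- resets the position.
    obtain ⟨k, hk, hpos⟩ : ∃ k ≥ n, ((D.state ρ k).exec e).pos = m + 1 := by
      have hsnn := hsn n le_rfl
      rcases (exec_tracks hagree hcpA hcpE hR hch he n).2 with h | ⟨h1, h2⟩
      · exact ⟨n, le_rfl, by omega⟩
      · obtain ⟨j, hj, x, hx, -⟩ := hch.receive_below e he n () _ rfl (by omega)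
        cases x with
        | msg x => exact absurd hx (hmsg j hj x)
        | tooOld p =>
          refine ⟨j + 1, by omega, ?_⟩
          rw [exec_step hx]
          simp only [execStep, hsn j hj]
    obtain ⟨j, hj, x, hx, hpj⟩ := hch.liveness1 () (m + 1) ⟨R (m + 1), m + 1⟩ F hF hcard
      (fun a ha => hsent a ha (m + 1) (by omega) le_rfl) e he k hpos
    cases x with
    | msg x => exact hmsg j (by omega) x hx
    | tooOld p =>
      -- `TooOld` for `m + 1` would need a window above `m + 1`, but the windows stay at or below
      -- `s₀ + 1 ≤ m + 1`.
      have := hch.receive_tooOld e he j () _ p ⟨hx, hpj⟩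
      have := hwin j
      omega

/-- An execution replica that reaches the multiple `m` of the checkpoint interval without the help
of a stable checkpoint generates the checkpoint for `m`. -/
theorem ExecReaches.genCp (hagree : D.IsAgreement ρ)
    (hcpA : (D.agreeCheckpoints ρ).IsCheckpoint D.correctAgree D.fa)
    (hcpE : (D.execCheckpoints ρ).IsCheckpoint D.correctExec D.fe)
    {R : ℕ → Request C Op} (hR : D.IsLog ρ R) {win : ℕ → Fin (2 * D.fe + 1) → Unit → ℕ}
    (hch : (D.commitChannel ρ).Valid D.correctAgree D.correctExec D.fa D.fe D.capC win)
    {e} (he : e ∈ D.correctExec) {m : ℕ} (hm : 1 ≤ m) (h : D.ExecReaches ρ e m)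
    (hke : m % D.ke = 0) (hst : ∀ n s x, ρ n = .exec e (.stable s x) → s < m) :
    ∃ n, D.execDoes ρ n e (.genCp m (execLog D.app R m)) := by
  classical
  obtain ⟨n, hn, hmin⟩ : ∃ n, m ≤ ((D.state ρ (n + 1)).exec e).sn ∧
      ((D.state ρ n).exec e).sn < m := by
    have hspec := Nat.find_spec h
    have hmin : ∀ k < Nat.find h, _ := fun k hk => Nat.find_min h hk
    cases hk : Nat.find h with
    | zero =>
      rw [hk] at hspec
      simp [state, execInit] at hspec
      omega
    | succ k =>
      rw [hk] at hspec hmin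
      exact ⟨k, hspec, not_le.mp (hmin k (Nat.lt_succ_self k))⟩
  refine ⟨n, ?_⟩
  rcases exec_cases ρ n e with ⟨i, hi, hs⟩ | ⟨-, hs⟩
  · rw [hs] at hn
    cases i with
    | write r mac =>
      rw [(execStep_write_fst r mac).1] at hn
      omega
    | received x =>
      cases x with
      | msg x =>
        simp only [execStep, execRequest] at hn
        obtain rfl : m = ((D.state ρ n).exec e).sn + 1 := by omega
        exact exec_genCp_eq hagree hcpA hcpE hR hch he hi hke
      | tooOld p =>
        simp only [execStep] at hn
        omega
    | sent c p r =>
      simp only [execStep] at hn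
      omega
    | stable s x =>
      have := hst n s x hi
      simp only [execStep] at hn
      split_ifs at hn
      all_goals
        simp only at hn
        omega
  · rw [hs] at hn
    omega

end Deployment

/-! ## Bounded and unbounded checkpointing -/

/-- Either every correct replica gets arbitrarily new stable checkpoints, or all of them get the
same newest one. -/
theorem CheckpointTrace.IsCheckpoint.unbounded_or {G X : Type*} {T : CheckpointTrace G X}
    {ok : Finset G} {f : ℕ} (h : T.IsCheckpoint ok f) :
    (∀ g ∈ ok, ∀ q, ∃ n s x, q ≤ s ∧ T.stable n g s x) ∨
    ∃ s₀, (∀ g ∈ ok, s₀ = 0 ∨ ∃ n x, T.stable n g s₀ x) ∧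
      ∀ g ∈ ok, ∀ n s x, T.stable n g s x → s ≤ s₀ := by
  classical
  by_cases hb : ∀ q, ∃ g ∈ ok, ∃ n s x, q ≤ s ∧ T.stable n g s x
  · left
    intro g hg q
    obtain ⟨g', hg', n, s, x, hs, hst⟩ := hb q
    obtain ⟨n', s', x', hst', hle⟩ := h.liveness g' hg' n s x hst g hg
    exact ⟨n', s', x', by omega, hst'⟩
  · right
    push Not at hb
    obtain ⟨q, hq⟩ := hb
    -- Including `0` covers the case in which no checkpoint ever becomes stable.
    let P : ℕ → Prop := fun s => s = 0 ∨ ∃ g ∈ ok, ∃ n x, T.stable n g s x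
    have hle : ∀ g ∈ ok, ∀ n s x, T.stable n g s x → s ≤ Nat.findGreatest P q := by
      intro g hg n s x hst
      refine Nat.le_findGreatest ?_ (.inr ⟨g, hg, n, x, hst⟩)
      by_contra hlt
      exact hq g hg n s x (by omega) hst
    have hP : P (Nat.findGreatest P q) := Nat.findGreatest_spec (Nat.zero_le q) (.inl rfl)
    refine ⟨Nat.findGreatest P q, fun g hg => ?_, hle⟩
    rcases hP with h0 | ⟨g', hg', n, x, hst⟩
    · exact .inl h0
    · obtain ⟨n', s', x', hst', hlt | ⟨rfl, rfl⟩⟩ := h.liveness g' hg' n _ x hst g hg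
      · have := hle g hg n' s' x' hst'
        omega
      · exact .inr ⟨n', x', hst'⟩

namespace Deployment

variable [DecidableEq C] [DecidableEq V] {D : Deployment C Op V St} {ρ : D.Run}

/-! ## Progress of the whole system -/

/-- This makes `s₀ + ka` again a checkpoint position when `s₀` is the newest stable one. -/
theorem agree_stable_mod (hcpA : (D.agreeCheckpoints ρ).IsCheckpoint D.correctAgree D.fa)
    {a} (ha : a ∈ D.correctAgree) {n s x} (h : ρ n = .agree a (.stable s x)) :
    s % D.ka = 0 := by
  obtain ⟨a', -, j, -, i, -, hgen⟩ := hcpA.safety a ha n s x h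
  obtain ⟨y, -, -, hk⟩ := genCp_mem_agreeStep hgen
  exact hk

theorem exec_stable_mod (hcpE : (D.execCheckpoints ρ).IsCheckpoint D.correctExec D.fe)
    {e} (he : e ∈ D.correctExec) {n s x} (h : ρ n = .exec e (.stable s x)) :
    s % D.ke = 0 := by
  obtain ⟨e', -, j, -, i, -, hgen⟩ := hcpE.safety e he n s x h
  obtain ⟨m, -, -, hk, -⟩ := genCp_mem_execStep hgen
  exact hk

/-- Beyond the newest stable agreement checkpoint `s₀`, fewer than `fa + 1` correct replicas get to
the next multiple of the checkpoint interval, provided that `send` calls return up to there. -/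
theorem not_all_agree_reach (hagree : D.IsAgreement ρ)
    (hcpA : (D.agreeCheckpoints ρ).IsCheckpoint D.correctAgree D.fa)
    {R : ℕ → Request C Op} (hR : D.IsLog ρ R) {s₀ : ℕ}
    (h0 : ∀ a ∈ D.correctAgree, s₀ = 0 ∨ ∃ n x, ρ n = .agree a (.stable s₀ x))
    (hmax : ∀ a ∈ D.correctAgree, ∀ n s x, ρ n = .agree a (.stable s x) → s ≤ s₀)
    (hq : D.SendsReturn ρ (s₀ + D.ka)) {F} (hF : F ⊆ D.correctAgree)
    (hcard : D.fa + 1 ≤ F.card) : ¬ ∀ a ∈ F, D.AgreeReaches ρ a (s₀ + D.ka) := by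
  intro hall
  have hka := D.ka_pos
  obtain ⟨a₀, ha₀⟩ : F.Nonempty := Finset.card_pos.mp (by omega)
  have hmod : (s₀ + D.ka) % D.ka = 0 := by
    rw [Nat.add_mod_right]
    rcases h0 a₀ (hF ha₀) with rfl | ⟨n, x, h⟩
    · exact Nat.zero_mod _
    · exact agree_stable_mod hcpA (hF ha₀) h
  -- None of the `fa + 1` replicas can have skipped `s₀ + ka` by a checkpoint, so all of them
  -- generate the same one there; it would become stable, contradicting maximality of `s₀`.
  obtain ⟨a, ha, n, s, x, hst, hle⟩ := hcpA.liveness2 (s₀ + D.ka) (agreeLog D.capC R (s₀ + D.ka))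
    F hF hcard fun a ha => (hall a ha).genCp hagree hcpA hR (hF ha) (by omega) hq hmod
      fun n s x h => by
        have := hmax a (hF ha) n s x h
        omega
  have := hmax a ha n s x hst
  omega

/-- A request that is covered by, or has blocked, `fa + 1` correct agreement replicas is in the log,
and every correct execution replica gets there. -/
theorem execReaches_of_covers (hfair : D.FairScheduling ρ) (hagree : D.IsAgreement ρ)
    (hcpA : (D.agreeCheckpoints ρ).IsCheckpoint D.correctAgree D.fa)
    (hcpE : (D.execCheckpoints ρ).IsCheckpoint D.correctExec D.fe)
    {R : ℕ → Request C Op} (hR : D.IsLog ρ R) {win : ℕ → Fin (2 * D.fe + 1) → Unit → ℕ}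
    (hch : (D.commitChannel ρ).Valid D.correctAgree D.correctExec D.fa D.fe D.capC win)
    {s r F} (hF : F ⊆ D.correctAgree) (hcard : D.fa + 1 ≤ F.card)
    (h : ∀ a ∈ F, D.Covers ρ a s r ∨ D.Stuck ρ a) :
    (∃ a ∈ F, D.Covers ρ a s r) ∧ ∀ e ∈ D.correctExec, D.ExecReaches ρ e s := by
  have hka := D.ka_pos
  have hke := D.ke_pos
  have hagWin := D.ka_le_agWin
  have hcapC := D.ke_le_capC
  obtain ⟨a₀, ha₀⟩ : F.Nonempty := Finset.card_pos.mp (by omega)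
  obtain ⟨e₀, he₀⟩ : D.correctExec.Nonempty :=
    Finset.card_pos.mp (by have := D.fe_lt_card_correctExec; omega)
  -- A stuck replica has got as far as the commit channel or its own window allows, whichever blocks
  -- it.
  have hstuck : ∀ {a q s₀}, a ∈ D.correctAgree → D.Stuck ρ a → D.SendsReturn ρ q → s₀ ≤ q →
      (s₀ = 0 ∨ ∃ n x, ρ n = .agree a (.stable s₀ x)) → ∀ m ≤ q, m ≤ s₀ + D.agWin →
      D.AgreeReaches ρ a m := by
    intro a q s₀ ha hst hq hs₀ h0 m h1 h2
    obtain ⟨sb, hsb⟩ := hst.blocked hagree hfair hcpA hR ha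
    rcases hsb q hq s₀ hs₀ h0 with ⟨h3, h4⟩ | ⟨h3, h4⟩
    · exact h4.mono (by omega)
    · exact h4.mono (by omega)
  rcases hcpE.unbounded_or with hE | ⟨e₁, hE0, hEmax⟩
  · have hsends : ∀ q, D.SendsReturn ρ q := by
      intro q
      refine (sendsReturn_of_win hch (q := q) fun e he => ?_).mono (Nat.le_add_right q D.capC)
      obtain ⟨n, s', x, hs', hst⟩ := hE e he q
      have := hch.win_move e he n () _ (commitMove_of_stable hst)
      exact ⟨n + 1, by omega⟩
    refine ⟨?_, fun e he => ?_⟩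
    -- If nobody covers `s`, all of `F` is stuck although every `send` returns. Unbounded agreement
    -- checkpoints would move the window past the blocked position; with a newest one, all of `F`
    -- would reach the next checkpoint.
    · by_contra hnc
      push Not at hnc
      have hst : ∀ a ∈ F, D.Stuck ρ a := fun a ha => (h a ha).resolve_left (hnc a ha)
      rcases hcpA.unbounded_or with hA | ⟨s₀, hA0, hAmax⟩
      · obtain ⟨sb, hsb⟩ := (hst a₀ ha₀).blocked hagree hfair hcpA hR (hF ha₀)
        obtain ⟨n, s', x, hs', hx⟩ := hA a₀ (hF ha₀) sb
        rcases hsb s' (hsends s') s' le_rfl (.inr ⟨n, x, hx⟩) with ⟨h1, -⟩ | ⟨h1, -⟩ <;> omega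
      · exact not_all_agree_reach hagree hcpA hR hA0 hAmax (hsends _) hF hcard fun a ha =>
          hstuck (hF ha) (hst a ha) (hsends (s₀ + D.ka)) (by omega) (hA0 a (hF ha)) _ le_rfl
            (by omega)
    · obtain ⟨n, s', x, hs', hst⟩ := hE e he s
      exact ⟨n + 1, hs'.trans (le_exec_sn_of_stable hst)⟩
  -- Execution checkpoints end at `e₁`. All other limits follow: commit windows end at `e₁ + 1`, and
  -- agreement checkpoints lie within one channel capacity.
  · have hAle : ∀ a ∈ D.correctAgree, ∀ n s x, ρ n = .agree a (.stable s x) →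
        s ≤ e₁ + D.capC := by
      intro a ha n s x hx
      by_contra hlt
      obtain ⟨e, he, j, s', x', hle, hst⟩ :=
        exists_exec_stable_of_agree_stable hagree hcpA hR hch ha hx (by omega)
      have := hEmax e he j s' x' hst
      omega
    have hwin_le : ∀ e ∈ D.correctExec, ∀ n, win n e () ≤ e₁ + 1 := by
      intro e he n
      by_contra hlt
      obtain ⟨e', he', j, s', x', hle, hst⟩ :=
        exists_stable_of_win hagree hcpA hR hch (q := win n e ()) (by omega) he le_rfl
      have := hEmax e' he' j s' x' hst
      omega
    have hwin_ge : ∀ e ∈ D.correctExec, ∃ n, e₁ + 1 ≤ win n e () := by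
      intro e he
      rcases hE0 e he with rfl | ⟨n, x, hx⟩
      · exact ⟨0, (hch.win_init e he ()).ge⟩
      · exact ⟨n + 1, hch.win_move e he n () _ (commitMove_of_stable hx)⟩
    have hreach0 : ∀ e ∈ D.correctExec, D.ExecReaches ρ e e₁ := by
      intro e he
      rcases hE0 e he with rfl | ⟨n, x, hx⟩
      · exact ⟨0, Nat.zero_le _⟩
      · exact ⟨n + 1, le_exec_sn_of_stable hx⟩
    have hsends := sendsReturn_of_win hch hwin_ge
    rcases hcpA.unbounded_or with hA | ⟨s₀, hA0, hAmax⟩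
    · obtain ⟨n, s', x, hs', hx⟩ := hA a₀ (hF ha₀) (e₁ + D.capC + 1)
      have := hAle a₀ (hF ha₀) n s' x hx
      omega
    have hs₀ : s₀ ≤ e₁ + D.capC := by
      rcases hA0 a₀ (hF ha₀) with rfl | ⟨n, x, hx⟩
      · exact Nat.zero_le _
      · exact hAle a₀ (hF ha₀) n s₀ x hx
    -- Only positions above `e₁` are needed. A checkpoint that skips such a position is at most `e₁
    -- + capC`, so its history still contains the message.
    have hexec : ∀ m ≤ e₁ + D.capC, (∀ a ∈ F, D.AgreeReaches ρ a m) →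
        ∀ e ∈ D.correctExec, D.ExecReaches ρ e m := by
      intro m hm hall e he
      rcases le_total m e₁ with hle | hle
      · exact (hreach0 e he).imp fun _ => hle.trans
      · refine ExecReaches.of_sent hagree hcpA hcpE hR hch he (hreach0 e he) (hwin_le e he) hF hcard
          (fun a ha p h1 h2 => ?_) hle
        exact ((hall a ha).mono h2).sent hagree hcpA hR (hF ha) (by omega) hsends (by omega)
          fun n s' x hx => by
            have := hAle a (hF ha) n s' x hx
            omega
    -- Whichever bound is smaller, reaching it would create a new stable checkpoint of the
    -- corresponding group; for `e₁ + ke` the execution replicas follow by `hexec`, using `ke ≤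
    -- capC`.
    have hnot : ¬ ∀ a ∈ F, D.AgreeReaches ρ a (min (s₀ + D.ka) (e₁ + D.ke)) := by
      intro hall
      rcases le_total (s₀ + D.ka) (e₁ + D.ke) with hle | hle
      · rw [min_eq_left hle] at hall
        exact not_all_agree_reach hagree hcpA hR hA0 hAmax (hsends.mono (by omega)) hF hcard hall
      · rw [min_eq_right hle] at hall
        have hmod : (e₁ + D.ke) % D.ke = 0 := by
          rw [Nat.add_mod_right]
          rcases hE0 e₀ he₀ with rfl | ⟨n, x, hx⟩
          · exact Nat.zero_mod _
          · exact exec_stable_mod hcpE he₀ hx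
        obtain ⟨e, he, n, s', x, hst, hle⟩ := hcpE.liveness2 (e₁ + D.ke)
          (execLog D.app R (e₁ + D.ke)) D.correctExec subset_rfl D.fe_lt_card_correctExec
          fun e he => (hexec _ (by omega) hall e he).genCp hagree hcpA hcpE hR hch he (by omega) hmod
            fun n s' x hx => by
              have := hEmax e he n s' x hx
              omega
        have := hEmax e he n s' x hst
        omega
    have hstuck' : ∀ a ∈ F, D.Stuck ρ a →
        D.AgreeReaches ρ a (min (s₀ + D.ka) (e₁ + D.ke)) := fun a ha hst =>
      hstuck (hF ha) hst hsends hs₀ (hA0 a (hF ha)) _ (by omega) (by omega)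
    push Not at hnot
    obtain ⟨a₁, ha₁, hna₁⟩ := hnot
    have hns : ¬ D.Stuck ρ a₁ := fun hst => hna₁ (hstuck' a₁ ha₁ hst)
    have hcov := (h a₁ ha₁).resolve_right hns
    -- The replica `a₁` covers and reaches `s` but not the bound, which places `s` below it; stuck
    -- members of `F` then reach `s` too.
    have hlt : s < min (s₀ + D.ka) (e₁ + D.ke) := by
      by_contra hle
      exact hna₁ ((hcov.reaches hagree (hF ha₁) hns).mono (not_lt.mp hle))
    refine ⟨⟨a₁, ha₁, hcov⟩, hexec s (by omega) fun a ha => ?_⟩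
    by_cases hst : D.Stuck ρ a
    · exact (hstuck' a ha hst).mono hlt.le
    · exact ((h a ha).resolve_right hst).reaches hagree (hF ha) hst

/-! ## From the client to the agreement replicas -/

/-- A request that arrives with a valid MAC at a correct execution replica. -/
theorem write_request (hcrypto : D.Unforgeable ρ) {c : C} (hc : c ∈ D.correctClients)
    {t : ℕ} {r : Request C Op}
    (hb : ∀ j r', D.clientDoes ρ j c (.broadcast r') → r'.counter < t ∨ r' = r)
    {e} (he : e ∈ D.correctExec) {n r'} (h : ρ n = .exec e (.write r' true))
    (hr' : r'.client = c) : r'.counter < t ∨ r' = r := by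
  subst hr'
  obtain ⟨j, -, hj⟩ := hcrypto.request_mac e he n r' hc h
  exact hb j r' hj

/-- Earlier requests of the client have smaller counters, and MACs cannot be forged. So `seen c` can
attain the counter of `r` only by accepting `r` itself, and that step forwards it. The case of
counter `0` accounts for the initial state. -/
theorem exec_seen (hcrypto : D.Unforgeable ρ) {c : C} (hc : c ∈ D.correctClients)
    {r : Request C Op}
    (hb : ∀ j r', D.clientDoes ρ j c (.broadcast r') → r'.counter < r.counter ∨ r' = r)
    {e} (he : e ∈ D.correctExec) (n : ℕ) :
    ((D.state ρ n).exec e).seen c ≤ r.counter ∧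
    (((D.state ρ n).exec e).seen c < r.counter ∨ r.counter = 0 ∨
      ∃ j, D.execDoes ρ j e (.reqMove c r.counter) ∧
        D.execDoes ρ j e (.reqSend c r.counter r)) := by
  induction n with
  | zero =>
    refine ⟨Nat.zero_le _, ?_⟩
    simp only [state, execInit]
    omega
  | succ n ih =>
    rcases exec_cases ρ n e with ⟨i, hi, hs⟩ | ⟨-, hs⟩
    · rw [hs]
      cases i with
      | write r' mac =>
        have hout : ∀ o, o ∈ (execStep D.ke D.app ((D.state ρ n).exec e) (.write r' mac)).2 →
            D.execDoes ρ n e o := fun o ho => ⟨_, hi, ho⟩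
        simp only [execStep] at hout ⊢
        split_ifs at hout ⊢ with h1 h2 h3
        · exact ih
        · split <;> exact ih
        · exact ih
        · have hmac : mac = true := by simpa using h1
          subst hmac
          simp only [Function.update_apply]
          split_ifs with hcc
          · subst hcc
            rcases write_request hcrypto hc hb he hi rfl with hlt | rfl
            · exact ⟨hlt.le, .inl hlt⟩
            · exact ⟨le_rfl, .inr (.inr ⟨n, hout _ (by simp), hout _ (by simp)⟩)⟩
          · exact ih
      | received x => cases x <;> exact ih
      | sent c p r => exact ih
      | stable s x =>
        simp only [execStep]
        split_ifs <;> exact ih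
    · rw [hs]
      exact ih

theorem exec_seen_mono (ρ : D.Run) (e) (c : C) :
    Monotone fun n => ((D.state ρ n).exec e).seen c := by
  refine monotone_nat_of_le_succ fun n => ?_
  rcases exec_cases ρ n e with ⟨i, -, hs⟩ | ⟨-, hs⟩
  · rw [hs]
    cases i with
    | write r mac =>
      simp only [execStep]
      split_ifs with h1 h2 h3
      · exact le_rfl
      · split <;> exact le_rfl
      · exact le_rfl
      · simp only [Function.update_apply]
        split_ifs with hc
        · subst hc
          exact (not_le.mp h2).le
        · exact le_rfl
    | received x => cases x <;> exact le_rfl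
    | sent c p r => exact le_rfl
    | stable s x =>
      simp only [execStep]
      split_ifs <;> exact le_rfl
  · rw [hs]

theorem le_exec_seen_of_write {n e} {r : Request C Op} (h : ρ n = .exec e (.write r true))
    (hsig : r.sig = true) : r.counter ≤ ((D.state ρ (n + 1)).exec e).seen r.client := by
  rw [exec_step h]
  by_cases hle : r.counter ≤ ((D.state ρ n).exec e).seen r.client
  · simp only [execStep, if_pos hle, Bool.true_eq_false, if_false]
    split <;> exact hle
  · simp [execStep, hle, hsig]

/-- Every correct execution replica forwards the request. -/
theorem exec_forwards (hcrypto : D.Unforgeable ρ) {c : C} (hc : c ∈ D.correctClients)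
    {r : Request C Op} (hrc : r.client = c) (hsig : r.sig = true) (ht : 1 ≤ r.counter)
    (hb : ∀ j r', D.clientDoes ρ j c (.broadcast r') → r'.counter < r.counter ∨ r' = r)
    {e} (he : e ∈ D.correctExec) {n} (h : ρ n = .exec e (.write r true)) :
    ∃ j, D.execDoes ρ j e (.reqMove c r.counter) ∧ D.execDoes ρ j e (.reqSend c r.counter r) := by
  rcases (exec_seen hcrypto hc hb he n).2 with hlt | h0 | hj
  · subst hrc
    exact ⟨n, ⟨_, h, by simp [execStep, not_le.mpr hlt, hsig]⟩, ⟨_, h, by simp [execStep, not_le.mpr hlt, hsig]⟩⟩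
  · omega
  · exact hj

/-- This traces local state back to the black-box event, to which validity and unforgeability of
signatures apply. -/
theorem deliver_of_waiting {n a s r}
    (h : ((D.state ρ n).agree a).deliv = some (.waiting s r)) : ∃ j, D.Delivers ρ j a s r := by
  induction n with
  | zero => simp [state, agreeInit] at h
  | succ n ih =>
    rcases agree_cases ρ n a with ⟨i, hi, hs⟩ | ⟨-, hs⟩
    · rw [hs] at h
      rcases agreeStep_deliv (ka := D.ka) (capC := D.capC) (agWin := D.agWin)
          (σ := (D.state ρ n).agree a) i with
          ⟨h1, -⟩ | ⟨s', r', rfl, h1⟩ | ⟨s', r', -, hd, hle, h1⟩ | ⟨s', r', rfl, hd, hw, hlt⟩ |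
          ⟨s', y, x, -, hd, h1, -⟩
      · exact ih (h1 ▸ h)
      · rw [h1] at h
        cases h
        exact ⟨n, hi⟩
      · rw [h1] at h
        cases h
      · rw [agreeStep_resume hd hw hlt] at h
        cases h
      · rw [h1] at h
        cases h
    · exact ih (hs ▸ h)

end Deployment

/-- How the position of the `receive` call on a request subchannel changes. -/
theorem agreeStep_next [DecidableEq C] {ka capC agWin : ℕ} {σ : AgreeState C Op}
    (i : AgreeIn C Op) (c : C) :
    ((agreeStep ka capC agWin σ i).1.pos c = σ.pos c ∧
      ((agreeStep ka capC agWin σ i).1.next c = σ.next c ∨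
      (∃ s r, i = .resume ∧ σ.deliv = some (.waiting s r) ∧ r.client = c ∧
        (agreeStep ka capC agWin σ i).1.next c = max (σ.next c) (r.counter + 1)) ∨
      ∃ s x, i = .stable s x ∧
        (agreeStep ka capC agWin σ i).1.next c = max (σ.next c) (x.1 c + 1))) ∨
    ((agreeStep ka capC agWin σ i).1.pos c = (agreeStep ka capC agWin σ i).1.next c ∧
      ((∃ p, i = .received c (.tooOld p) ∧
        (agreeStep ka capC agWin σ i).1.next c = max (σ.next c) p) ∨
      ∃ r, i = .received c (.msg r) ∧
        (agreeStep ka capC agWin σ i).1.next c = max (σ.next c) (r.counter + 1))) := by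
  cases i with
  | received c' x =>
    by_cases hc : c = c'
    · subst hc
      cases x with
      | msg r => exact .inr ⟨by simp [agreeStep], .inr ⟨r, rfl, by simp [agreeStep]⟩⟩
      | tooOld p => exact .inr ⟨by simp [agreeStep], .inl ⟨p, rfl, by simp [agreeStep]⟩⟩
    · cases x <;> exact .inl (by simp [agreeStep, Function.update_of_ne hc])
  | deliver s r => exact .inl ⟨rfl, .inl rfl⟩
  | resume =>
    left
    cases hd : σ.deliv with
    | none => simp [agreeStep, hd]
    | some ph =>
      cases ph with
      | sending s x => simp [agreeStep, hd]
      | waiting s r =>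
        by_cases h1 : σ.winMax < s
        · simp [agreeStep, hd, h1]
        · by_cases h2 : s ≤ σ.sn
          · simp [agreeStep, hd, h1, h2]
          · rw [agreeStep_resume hd (not_lt.mp h1) (not_le.mp h2)]
            refine ⟨rfl, ?_⟩
            by_cases hc : c = r.client
            · subst hc
              exact .inr (.inl ⟨s, r, rfl, rfl, rfl, Function.update_self _ _ _⟩)
            · exact .inl (Function.update_of_ne hc _ _)
  | sent p y =>
    obtain ⟨-, -, -, -, -, h1, h2⟩ := agreeStep_sent_fst (ka := ka) (capC := capC) (agWin := agWin)
      (σ := σ) p y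
    exact .inl ⟨by rw [h2], .inl (by rw [h1])⟩
  | stable s x =>
    left
    simp only [agreeStep]
    split_ifs
    · exact ⟨rfl, .inr (.inr ⟨s, x, rfl, rfl⟩)⟩
    · exact ⟨rfl, .inl rfl⟩

namespace Deployment

variable [DecidableEq C] [DecidableEq V] {D : Deployment C Op V St} {ρ : D.Run}

/-- `next` can jump on delivery or on a checkpoint while a `receive` call is outstanding; the
position catches up when that call returns. -/
theorem agree_pos_le_next (ρ : D.Run) (a) (c : C) (n : ℕ) :
    ((D.state ρ n).agree a).pos c ≤ ((D.state ρ n).agree a).next c ∧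
    ((D.state ρ n).agree a).pos c ≤ ((D.state ρ (n + 1)).agree a).pos c := by
  have hstep : ∀ n, ((D.state ρ n).agree a).pos c ≤ ((D.state ρ n).agree a).next c →
      ((D.state ρ (n + 1)).agree a).pos c ≤ ((D.state ρ (n + 1)).agree a).next c ∧
      ((D.state ρ n).agree a).pos c ≤ ((D.state ρ (n + 1)).agree a).pos c := by
    intro n hn
    rcases agree_cases ρ n a with ⟨i, -, hs⟩ | ⟨-, hs⟩
    · rw [hs]
      rcases agreeStep_next (ka := D.ka) (capC := D.capC) (agWin := D.agWin)
        (σ := (D.state ρ n).agree a) i c with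
        ⟨h1, h2 | ⟨s, r, -, -, -, h2⟩ | ⟨s, x, -, h2⟩⟩ | ⟨h1, ⟨p, -, h2⟩ | ⟨r, -, h2⟩⟩
      all_goals
        rw [h1, h2]
        omega
    · rw [hs]
      exact ⟨hn, le_rfl⟩
  have hall : ∀ n, ((D.state ρ n).agree a).pos c ≤ ((D.state ρ n).agree a).next c := by
    intro n
    induction n with
    | zero => exact le_rfl
    | succ n ih => exact (hstep n ih).1
  exact ⟨hall n, (hstep n (hall n)).2⟩

/-- The request channel of a correct client whose newest request is `r`: every correct agreement
replica receives `r`, or learns that it has been agreed on already. -/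
theorem agree_orders (hcrypto : D.Unforgeable ρ) (hagree : D.IsAgreement ρ)
    (hcpA : (D.agreeCheckpoints ρ).IsCheckpoint D.correctAgree D.fa)
    {win : ℕ → Fin (3 * D.fa + 1) → C → ℕ}
    (hch : (D.requestChannel ρ).Valid D.correctExec D.correctAgree D.fe D.fa D.capR win)
    {c : C} (hc : c ∈ D.correctClients)
    {r : Request C Op} (hrc : r.client = c) (hsig : r.sig = true) (ht : 1 ≤ r.counter)
    (hb : ∀ j r', D.clientDoes ρ j c (.broadcast r') → r'.counter < r.counter ∨ r' = r)
    (harr : ∀ e ∈ D.correctExec, ∃ n, ρ n = .exec e (.write r true))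
    {R : ℕ → Request C Op} (hR : D.IsLog ρ R)
    (hRle : ∀ s, (R s).client = c → (R s).counter ≤ r.counter)
    (hReq : ∀ s, (R s).client = c → (R s).counter = r.counter →
      ∃ a ∈ D.correctAgree, ∃ n, D.Delivers ρ n a s r)
    {a} (ha : a ∈ D.correctAgree) :
    (∃ n, D.agreeDoes ρ n a (.order r)) ∨ ∃ s, D.Covers ρ a s r := by
  by_contra hno
  push Not at hno
  obtain ⟨hno1, hno2⟩ := hno
  have hcapR := D.capR_pos
  have hfwd := fun e (he : e ∈ D.correctExec) =>
    (harr e he).elim fun n hn => exec_forwards hcrypto hc hrc hsig ht hb he hn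
  -- Receivers never move this window, and correct senders move it only to counters of authentic
  -- requests, none above that of `r`.
  have hwin_le : ∀ b ∈ D.correctAgree, ∀ n, win n b c ≤ r.counter := by
    intro b hbc n
    by_contra hlt
    rcases hch.win_origin b hbc n c (by omega) with
      ⟨e, he, j, -, p, hp, i, hi, hm⟩ | ⟨b', -, j, -, p, -, ⟨⟩⟩
    obtain ⟨r', rfl, rfl, rfl⟩ := reqMove_mem_execStep hm
    rcases write_request hcrypto hc hb he hi rfl with h | rfl <;> omega
  have hwin_ge : ∀ b ∈ D.correctAgree, ∃ n, r.counter ≤ win n b c :=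
    hch.liveness3 c r.counter D.correctExec subset_rfl D.fe_lt_card_correctExec fun e he =>
      (hfwd e he).imp fun n hn => ⟨r.counter, le_rfl, hn.1⟩
  have hsent : ∀ e ∈ D.correctExec, ∃ n, (D.requestChannel ρ).sendReturns n e c r.counter r := by
    intro e he
    obtain ⟨n, -, hn⟩ := hfwd e he
    have hcardA := D.two_fa_lt_card_correctAgree
    obtain ⟨j, -, hj⟩ := hch.liveness2 c r.counter D.correctAgree subset_rfl (by omega) hwin_ge e he
      n r.counter r hn (by omega)
    exact ⟨j, hj⟩
  have hmsg : ∀ n r', ρ n = .agree a (.received c (.msg r')) →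
      r'.counter = ((D.state ρ n).agree a).pos c ∧ r'.counter < r.counter := by
    intro n r' hn
    obtain ⟨⟨e, he, j, -, i, hi, hs⟩, -⟩ := hch.receive_msg a ha n c _ r' ⟨hn, rfl⟩
    obtain ⟨rfl, rfl, h3⟩ := reqSend_mem_execStep hs
    refine ⟨h3.symm, (write_request hcrypto hc hb he hi rfl).resolve_right ?_⟩
    rintro rfl
    exact hno1 n ⟨_, hn, by simp [agreeStep]⟩
  -- Passing the counter of `r` would require receiving `r`, being delivered `r`, or adopting a
  -- checkpoint that contains `r`. All three are excluded by assumption; in the last case the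
  -- accompanying `gc` call would make the replica cover `r`.
  have hnext : ∀ n, ((D.state ρ n).agree a).next c ≤ r.counter := by
    intro n
    induction n with
    | zero => exact ht
    | succ n ih =>
      rcases agree_cases ρ n a with ⟨i, hi, hs⟩ | ⟨-, hs⟩
      · rw [hs]
        rcases agreeStep_next (ka := D.ka) (capC := D.capC) (agWin := D.agWin)
          (σ := (D.state ρ n).agree a) i c with
          ⟨-, h2 | ⟨s, r', -, hd, hcr, h2⟩ | ⟨s, x, rfl, h2⟩⟩ | ⟨-, ⟨p, rfl, h2⟩ | ⟨r', rfl, h2⟩⟩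
        · rw [h2]
          exact ih
        · rw [h2]
          obtain ⟨j, hj⟩ := deliver_of_waiting hd
          have hsig' := hagree.validity a ha j s r' hj
          obtain ⟨k, -, hk⟩ := hcrypto.request_sig a ha j s r' (hcr ▸ hc) hsig' hj
          rw [hcr] at hk
          rcases hb k r' hk with hlt | rfl
          · exact max_le ih hlt
          · exact absurd (.inl ⟨j, hj⟩) (hno2 s)
        · rw [h2]
          refine max_le ih (Nat.succ_le_of_lt (lt_of_le_of_ne ?_ fun heq => ?_))
          · rw [agree_stable_eq hagree hcpA hR ha hi]
            exact agreeLog_counter_le hRle s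
          · rw [agree_stable_eq hagree hcpA hR ha hi] at heq
            obtain ⟨s', hs', hcl, hct⟩ := exists_of_agreeLog_counter ht heq
            refine hno2 s' (.inr ⟨hReq s' hcl hct, n, s + 1, by omega, _, hi, ?_⟩)
            simp only [agreeStep]
            split_ifs <;> simp
        · rw [h2]
          exact max_le ih ((hch.receive_tooOld a ha n c _ p ⟨hi, rfl⟩).2.trans (hwin_le a ha n))
        · rw [h2]
          exact max_le ih (hmsg n r' hi).2
      · rw [hs]
        exact ih
  have hmono : Monotone fun n => ((D.state ρ n).agree a).pos c :=
    monotone_nat_of_le_succ fun n => (agree_pos_le_next ρ a c n).2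
  -- Positions below the final window never block, and each return raises the position by at least
  -- one.
  have hpos : ∀ p ≤ r.counter, ∃ n, p ≤ ((D.state ρ n).agree a).pos c := by
    intro p
    induction p with
    | zero => exact fun _ => ⟨0, Nat.zero_le _⟩
    | succ p ih =>
      intro hp
      obtain ⟨n, hn⟩ := ih (by omega)
      obtain ⟨N, hN⟩ := hwin_ge a ha
      have hwm : Monotone fun n => win n a c := monotone_nat_of_le_succ fun n => hch.win_mono a ha c n
      have h1 : ((D.state ρ n).agree a).pos c ≤ ((D.state ρ (max n N)).agree a).pos c :=
        hmono (le_max_left n N)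
      have h2 : win N a c ≤ win (max n N) a c := hwm (le_max_right n N)
      by_cases hlt : p + 1 ≤ ((D.state ρ (max n N)).agree a).pos c
      · exact ⟨_, hlt⟩
      · obtain ⟨j, hj, x, hx, hpj⟩ := hch.receive_below a ha (max n N) c p
          (by simp only [requestChannel]; omega) (by omega)
        refine ⟨j + 1, ?_⟩
        rw [agree_step hx]
        cases x with
        | msg r' =>
          have := (hmsg j r' hx).1
          simp only [agreeStep, Function.update_self]
          omega
        | tooOld p' =>
          have := (hch.receive_tooOld a ha j c p p' ⟨hx, hpj⟩).1
          simp only [agreeStep, Function.update_self]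
          omega
  obtain ⟨n, hn⟩ := hpos r.counter le_rfl
  have hpn : ((D.state ρ n).agree a).pos c = r.counter :=
    le_antisymm ((agree_pos_le_next ρ a c n).1.trans (hnext n)) hn
  -- The call at the counter of `r` must return, yet `r` is excluded by assumption, older requests
  -- have another position, and `TooOld` would need a window above that counter.
  obtain ⟨j, -, x, hx, hpj⟩ := hch.liveness1 c r.counter r D.correctExec subset_rfl
    D.fe_lt_card_correctExec hsent a ha n hpn
  cases x with
  | msg r' =>
    have := hmsg j r' hx
    omega
  | tooOld p' =>
    have h1 := hch.receive_tooOld a ha j c _ p' ⟨hx, hpj⟩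
    have h2 := hwin_le a ha j
    omega

end Deployment

end Spider

/-! ### Assembling the liveness theorem. -/

open Spider in
theorem mainTheorem3 {C Op V St : Type*} [DecidableEq C] [DecidableEq V]
    (D : Deployment C Op V St) (ρ : D.Run)
    (hcrypto : D.Unforgeable ρ)
    (hnet : D.PartiallySynchronous ρ)
    (hfair : D.FairScheduling ρ)
    (hreq : (D.requestChannel ρ).IsIrmc D.correctExec D.correctAgree D.fe D.fa D.capR)
    (hcommit : (D.commitChannel ρ).IsIrmc D.correctAgree D.correctExec D.fa D.fe D.capC)
    (hagree : D.IsAgreement ρ)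
    (hcpExec : (D.execCheckpoints ρ).IsCheckpoint D.correctExec D.fe)
    (hcpAgree : (D.agreeCheckpoints ρ).IsCheckpoint D.correctAgree D.fa)
    (c : C) (hc : c ∈ D.correctClients) (n : ℕ) (w : Op)
    (hidle : ((D.state ρ n).client c).pending = none)
    (hissue : ρ n = .client c (.issue w)) :
    ∃ k > n, ∃ v : V,
      D.clientDoes ρ k c (.accept ((D.state ρ n).client c).counter v) := by
  classical
  by_contra hno
  push Not at hno
  obtain ⟨winR, hchR⟩ := hreq
  obtain ⟨winC, hchC⟩ := hcommit
  have ht := (Deployment.client_broadcasts ρ c n).1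
  have hwait := fun k (hk : n < k) => (Deployment.client_waits hidle hissue hno hk).2
  have hb := fun j r' (h : D.clientDoes ρ j c (.broadcast r')) =>
    Deployment.broadcast_of_unanswered hidle hissue hno h
  set t := ((D.state ρ n).client c).counter with ht_def
  set r : Request C Op := ⟨c, t, w, true⟩ with hr
  have harr := fun e (he : e ∈ D.correctExec) =>
    Deployment.write_arrives hnet hfair hc hwait he
  -- positions that are never delivered get a harmless default entry
  let R : ℕ → Request C Op := fun s =>
    if h : ∃ r', ∃ a ∈ D.correctAgree, ∃ k, D.Delivers ρ k a s r' then h.choose else ⟨c, 0, w, false⟩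
  have hRspec : ∀ s, (∃ a ∈ D.correctAgree, ∃ k, D.Delivers ρ k a s (R s)) ∨
      R s = ⟨c, 0, w, false⟩ := by
    intro s
    by_cases h : ∃ r', ∃ a ∈ D.correctAgree, ∃ k, D.Delivers ρ k a s r'
    · left
      simp only [R, dif_pos h]
      exact h.choose_spec
    · right
      simp only [R, dif_neg h]
  have hR : D.IsLog ρ R := by
    intro a ha k s r' hd
    have h : ∃ r', ∃ a ∈ D.correctAgree, ∃ k, D.Delivers ρ k a s r' := ⟨r', a, ha, k, hd⟩
    simp only [R, dif_pos h]
    obtain ⟨a', ha', k', hd'⟩ := h.choose_spec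
    exact hagree.safety a ha a' ha' k k' s _ _ hd hd'
  -- Delivered requests of `c` carry valid signatures and so were broadcast by `c`; default entries
  -- have counter `0 < t`.
  have hRc : ∀ s, (R s).client = c → (R s).counter < t ∨
      (R s = r ∧ ∃ a ∈ D.correctAgree, ∃ k, D.Delivers ρ k a s r) := by
    intro s hs
    rcases hRspec s with ⟨a, ha, k, hd⟩ | h0
    · obtain ⟨j, -, hj⟩ := hcrypto.request_sig a ha k s (R s) (hs ▸ hc)
        (hagree.validity a ha k s _ hd) hd
      rw [hs] at hj
      rcases hb j _ hj with hlt | heq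
      · exact .inl hlt
      · exact .inr ⟨heq, a, ha, k, heq ▸ hd⟩
    · rw [h0]
      exact .inl ht
  have hRle : ∀ s, (R s).client = c → (R s).counter ≤ t := by
    intro s hs
    rcases hRc s hs with h | ⟨h, -⟩
    · exact h.le
    · rw [h]
  have horder := fun a (ha : a ∈ D.correctAgree) =>
    Deployment.agree_orders hcrypto hagree hcpAgree hchR hc (r := r) rfl rfl ht hb
      (fun e he => (harr e he 0).imp fun _ h => h.2) hR hRle
      (fun s h1 h2 => ((hRc s h1).resolve_left (by rw [h2]; exact lt_irrefl _)).2) ha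
  obtain ⟨s, F, hF, hcard, hcov⟩ := hagree.liveness r D.correctAgree subset_rfl
    D.two_fa_lt_card_correctAgree horder
  obtain ⟨⟨a, haF, hca⟩, hreach⟩ := Deployment.execReaches_of_covers hfair hagree hcpAgree hcpExec hR
    hchC hF hcard hcov
  have hRs : R s = r := hca.eq_log hR (hF haF)
  have hs1 : 1 ≤ s := by
    rcases hca with ⟨k, hk⟩ | ⟨⟨a', ha', k, hk⟩, -⟩
    · exact (hagree.order a (hF haF) k s r hk).1
    · exact (hagree.order a' ha' k s r hk).1
  obtain ⟨v₀, hv₀⟩ := exists_execLog (app := D.app) hRle hs1 (by rw [hRs]) (by rw [hRs])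
  -- The reply sent at execution may be lost before GST, and a replica that skips `s` by a
  -- checkpoint sends none. Retransmissions are answered from the stored reply instead.
  have hreply : ∀ e ∈ D.correctExec, ∀ m, ∃ k > m, D.execDoes ρ k e (.reply c t v₀) := by
    intro e he m
    obtain ⟨N, hN⟩ := hreach e he
    -- Two arrivals are needed: the first brings `seen c` to `t`, so that the second, after `s` has
    -- been passed, is answered rather than forwarded.
    obtain ⟨k₁, -, hw₁⟩ := harr e he 0
    obtain ⟨k, hk, hw⟩ := harr e he (max (max m N) k₁)
    refine ⟨k, by omega, _, hw, ?_⟩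
    have hlast : ((D.state ρ k).exec e).last c = some (t, v₀) := by
      have h1 := (Deployment.exec_tracks hagree hcpAgree hcpExec hR hchC he k).1
      have h2 : ((D.state ρ N).exec e).sn ≤ ((D.state ρ k).exec e).sn :=
        Deployment.exec_sn_mono ρ e (by omega)
      have h3 := execLog_stays (app := D.app) hRle (hN.trans h2) hv₀
      rw [← h1] at h3
      exact h3
    have hseen : t ≤ ((D.state ρ k).exec e).seen c := by
      have h1 := Deployment.le_exec_seen_of_write hw₁ rfl
      have h2 : ((D.state ρ (k₁ + 1)).exec e).seen c ≤ ((D.state ρ k).exec e).seen c :=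
        Deployment.exec_seen_mono ρ e c (by omega)
      exact h1.trans h2
    simp [execStep, hr, hseen, hlast]
  have huniq : ∀ e ∈ D.correctExec, ∀ m v, D.execDoes ρ m e (.reply c t v) → v = v₀ := by
    intro e he m v hv
    obtain ⟨s', hs'⟩ := Deployment.exec_reply_log hagree hcpAgree hcpExec hR hchC he hv
    exact execLog_unique hRle hs' hv₀
  obtain ⟨k, hk, v, hv⟩ :=
    Deployment.not_waiting_of_replies hcrypto hnet hc ht_def.symm hidle hissue hreply huniq
  exact hno k hk v hv
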